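/- Let $n,p$ be positive integers, $\Delta>0$, and let $\mathcal C$ be the Banach space of continuous functions $[-\Delta,0]\to\mathbb R^n$ with the supremum norm $\|\cdot\|$, where $|\cdot|$ denotes the Euclidean norm on $\mathbb R^n$. Let $\mathcal D\phi=\phi(0)-\sum_{j=1}^p A_j\phi(-\Delta_j)$ for $\phi\in\mathcal C$, with $0<\Delta_j\le\Delta$ and $A_j\in\mathbb R^{n\times n}$, and assume that $\mathcal D$ is strongly stable: for every choice of positive delays $r_1,\dots,r_p$, the zero solution of the difference equation $y(t)=\sum_{j=1}^pA_jy(t-r_j)$, $t\ge0$, with continuous initial data satisfying the equation at $t=0$, is uniformly asymptotically stable. Let $f:\mathcal C\to\mathbb R^n$ be Lipschitz on bounded sets with $f(0)=0$, and consider the neutral functional differential equation $$\frac{d}{dt}\mathcal D x_t=f(x_t),\quad t\ge 0,\qquad x(\tau)=\xi_0(\tau),\quad \tau\in[-\Delta,0],\qquad \xi_0\in\mathcal C, \tag{1}$$ where $x_t(\tau)=x(t+\tau)$ for $\tau\in[-\Delta,0]$. System (1) is called $0$-GES if there exist $M,\lambda>0$ such that for every $\xi_0\in\mathcal C$ the solution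 of (1) exists for all $t\ge0$ and satisfies $|x(t)|\le Me^{-\lambda t}\|\xi_0\|$ for all $t\ge 0$. For $V:\mathcal C\to[0,\infty)$ and $\phi\in\mathcal C$ put $$D^+V(\phi)=\limsup_{h\to0^+}\frac{V(\phi_h)-V(\phi)}{h}\in[-\infty,+\infty],$$ where, for $0<h<\Delta$, $\phi_h\in\mathcal C$ is given by $\phi_h(s)=\phi(s+h)$ for $s\in[-\Delta,-h]$ and $\phi_h(s)=\mathcal D\phi+f(\phi)(s+h)-\mathcal D\phi^\star_{s+h}+\phi(0)$ for $s\in(-h,0]$, and, for $0<\theta\le h$, $\phi^\star_\theta(s)=\phi(s+\theta)$ for $s\in[-\Delta,-\theta]$ and $\phi^\star_\theta(s)=\phi(0)$ for $s\in(-\theta,0]$. **Theorem.** System (1) is $0$-GES if and only if there exist a locally Lipschitz functional $V:\mathcal C\to[0,\infty)$ and positive reals $a_1,a_2,a_3$ such that, for all $\phi\in\mathcal C$, 1. $a_1|\mathcal D\phi|\le V(\phi)\le a_2\|\phi\|$; 2. $D^+V(\phi)\le -a_3V(\phi)$. -/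

import Mathlib

open Set Filter Topology

noncomputable section

/-- The Banach space of continuous functions `[-Δ, 0] → ℝⁿ` with the supremum norm,
`ℝⁿ` carrying the Euclidean norm. -/
abbrev PhaseSpace (n : ℕ) (Δ : ℝ) : Type :=
  C(Set.Icc (-Δ) (0 : ℝ), EuclideanSpace ℝ (Fin n))

/-- The segment `x_t ∈ C([-Δ, 0], ℝⁿ)`, `x_t(τ) = x(t + τ)`. -/
def segment_at {n : ℕ} (Δ : ℝ) (x : C(ℝ, EuclideanSpace ℝ (Fin n))) (t : ℝ) :
    PhaseSpace n Δ where
  toFun τ := x (t + (τ : ℝ))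
  continuous_toFun := by fun_prop

/-- `Q` is Lipschitz on bounded sets. -/
def LipschitzOnBoundedSets {n : ℕ} {Δ : ℝ}
    (Q : PhaseSpace n Δ → EuclideanSpace ℝ (Fin n)) : Prop :=
  ∀ H : ℝ, 0 < H → ∃ L : ℝ, 0 < L ∧ ∀ φ₁ φ₂ : PhaseSpace n Δ,
    ‖φ₁‖ ≤ H → ‖φ₂‖ ≤ H → ‖Q φ₁ - Q φ₂‖ ≤ L * ‖φ₁ - φ₂‖

/-- The data of a difference operator
`𝒟 φ = φ(0) - ∑ j, A_j φ(-Δ_j)` with delays `0 < Δ_j ≤ Δ`. -/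
structure DifferenceOperator (n p : ℕ) where
  /-- the maximal delay -/
  Δ : ℝ
  Δ_pos : 0 < Δ
  /-- the delays `Δ_j` -/
  delay : Fin p → ℝ
  delay_pos : ∀ j, 0 < delay j
  delay_le : ∀ j, delay j ≤ Δ
  /-- the matrices `A_j` -/
  A : Fin p → Matrix (Fin n) (Fin n) ℝ

namespace DifferenceOperator

variable {n p : ℕ} (D : DifferenceOperator n p)

/-- The point `0` of `[-Δ, 0]`. -/
def zeroPt : Set.Icc (-D.Δ) (0 : ℝ) :=
  ⟨0, by have := D.Δ_pos; linarith, le_refl 0⟩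

/-- The point `-Δ_j` of `[-Δ, 0]`. -/
def delayPt (j : Fin p) : Set.Icc (-D.Δ) (0 : ℝ) :=
  ⟨-D.delay j, neg_le_neg (D.delay_le j), by have := D.delay_pos j; linarith⟩

/-- `𝒟 φ = φ(0) - ∑ j, A_j φ(-Δ_j)`. -/
def apply (φ : PhaseSpace n D.Δ) : EuclideanSpace ℝ (Fin n) :=
  φ D.zeroPt - ∑ j, Matrix.toEuclideanCLM (𝕜 := ℝ) (D.A j) (φ (D.delayPt j))

/-- `y` solves the homogeneous difference equation `𝒟 y_t = 0`, `t ≥ 0`. Only the values of `y`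
on `[-Δ, ∞)` matter. -/
def IsHomogeneousSolution (y : C(ℝ, EuclideanSpace ℝ (Fin n))) : Prop :=
  ∀ t : ℝ, 0 ≤ t → D.apply (segment_at D.Δ y t) = 0

/-- `𝒟` is stable: the zero solution of `𝒟 y_t = 0`, `t ≥ 0`, is uniformly asymptotically
stable (the initial segments `y_0` range over the kernel of `𝒟`). -/
def IsStable : Prop :=
  (∀ ε : ℝ, 0 < ε → ∃ δ : ℝ, 0 < δ ∧
    ∀ y : C(ℝ, EuclideanSpace ℝ (Fin n)), D.IsHomogeneousSolution y →
      ‖segment_at D.Δ y 0‖ < δ → ∀ t : ℝ, 0 ≤ t → ‖segment_at D.Δ y t‖ < ε) ∧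
  (∃ b : ℝ, 0 < b ∧ ∀ η : ℝ, 0 < η → ∃ T : ℝ, 0 ≤ T ∧
    ∀ y : C(ℝ, EuclideanSpace ℝ (Fin n)), D.IsHomogeneousSolution y →
      ‖segment_at D.Δ y 0‖ < b → ∀ t : ℝ, T ≤ t → ‖segment_at D.Δ y t‖ < η)

/-- `𝒟` is strongly stable: the difference operator with the same matrices is stable for every
choice of positive delays (and every bound of these delays as length of the memory interval). -/
def IsStronglyStable : Prop :=
  ∀ D' : DifferenceOperator n p, D'.A = D.A → D'.IsStable

/-- A function on `[-Δ, 0]` extended to `ℝ` by its end values (used only so that `φ (s + θ)` can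
be written without a proof that `s + θ ∈ [-Δ, 0]`). -/
def ext (φ : PhaseSpace n D.Δ) : ℝ → EuclideanSpace ℝ (Fin n) :=
  Set.IccExtend (neg_nonpos.mpr D.Δ_pos.le) φ

theorem continuous_ext (φ : PhaseSpace n D.Δ) : Continuous (D.ext φ) :=
  φ.continuous.Icc_extend'

theorem ext_of_mem (φ : PhaseSpace n D.Δ) {s : ℝ} (hs : s ∈ Set.Icc (-D.Δ) 0) :
    D.ext φ s = φ ⟨s, hs⟩ :=
  Set.IccExtend_of_mem _ _ hs

theorem ext_of_nonneg (φ : PhaseSpace n D.Δ) {s : ℝ} (hs : 0 ≤ s) :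
    D.ext φ s = φ D.zeroPt :=
  Set.IccExtend_of_right_le _ _ hs

theorem frozen_eq (φ : PhaseSpace n D.Δ) (θ s : ℝ) :
    (if s ≤ -θ then D.ext φ (s + θ) else φ D.zeroPt) = D.ext φ (s + θ) := by
  split_ifs with h
  · rfl
  · exact (D.ext_of_nonneg φ (by linarith)).symm

/-- `φ*_θ` (for `θ ≥ 0`): `φ*_θ(s) = φ(s + θ)` on `[-Δ, -θ]` and `φ*_θ(s) = φ(0)`
on `(-θ, 0]`. -/
def frozen (φ : PhaseSpace n D.Δ) (θ : ℝ) : PhaseSpace n D.Δ where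
  toFun s := if (s : ℝ) ≤ -θ then D.ext φ ((s : ℝ) + θ) else φ D.zeroPt
  continuous_toFun := by
    simp only [frozen_eq]
    exact (D.continuous_ext φ).comp (by fun_prop)

theorem frozen_apply (φ : PhaseSpace n D.Δ) (θ : ℝ) (s : Set.Icc (-D.Δ) (0 : ℝ)) :
    D.frozen φ θ s = D.ext φ ((s : ℝ) + θ) :=
  D.frozen_eq φ θ s

theorem continuous_apply_frozen (φ : PhaseSpace n D.Δ) :
    Continuous fun θ : ℝ => D.apply (D.frozen φ θ) := by
  have h := D.continuous_ext φ
  simp only [apply, frozen_apply]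
  fun_prop

theorem apply_frozen_zero (φ : PhaseSpace n D.Δ) : D.apply (D.frozen φ 0) = D.apply φ := by
  have h : D.frozen φ 0 = φ := by
    ext1 s
    rw [frozen_apply, add_zero, D.ext_of_mem φ s.2]
  rw [h]

end DifferenceOperator

/-- The data of the neutral functional differential equation
`d/dt 𝒟 x_t = f(x_t)`, `t ≥ 0`. -/
structure NeutralSystem (n p : ℕ) extends DifferenceOperator n p where
  /-- the right-hand side -/
  f : PhaseSpace n Δ → EuclideanSpace ℝ (Fin n)

namespace NeutralSystem

variable {n p : ℕ} (S : NeutralSystem n p)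

/-- The operator `𝒟` of the system. -/
abbrev D : DifferenceOperator n p := S.toDifferenceOperator

/-- `x` is a solution on the whole of `[0, ∞)` with initial condition `ξ₀`: `x` is continuous,
`x = ξ₀` on `[-Δ, 0]`, and `t ↦ 𝒟 x_t` is differentiable on `[0, ∞)` (from the right at `0`) with
derivative `f(x_t)`. Only the values of `x` on `[-Δ, ∞)` matter. -/
def IsSolution (ξ₀ : PhaseSpace n S.Δ) (x : C(ℝ, EuclideanSpace ℝ (Fin n))) : Prop :=
  segment_at S.Δ x 0 = ξ₀ ∧
  ∀ t : ℝ, 0 ≤ t →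
    HasDerivWithinAt (fun s : ℝ => S.D.apply (segment_at S.Δ x s))
      (S.f (segment_at S.Δ x t)) (Set.Ici 0) t

/-- The system is 0-GES. -/
def IsZeroGES : Prop :=
  ∃ M lam : ℝ, 0 < M ∧ 0 < lam ∧ ∀ ξ₀ : PhaseSpace n S.Δ,
    (∃ x, S.IsSolution ξ₀ x) ∧
    ∀ x, S.IsSolution ξ₀ x → ∀ t : ℝ, 0 ≤ t → ‖x t‖ ≤ M * Real.exp (-lam * t) * ‖ξ₀‖

theorem driverStep_eq (φ : PhaseSpace n S.Δ) (h s : ℝ) :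
    (if s ≤ -h then S.D.ext φ (s + h)
      else S.D.apply φ + (s + h) • S.f φ - S.D.apply (S.D.frozen φ (s + h)) + φ S.D.zeroPt) =
    S.D.ext φ (s + h) + max (s + h) 0 • S.f φ + S.D.apply φ
      - S.D.apply (S.D.frozen φ (max (s + h) 0)) := by
  split_ifs with hs
  · rw [max_eq_right (by linarith), S.D.apply_frozen_zero]
    simp
  · rw [max_eq_left (by linarith), S.D.ext_of_nonneg φ (by linarith : 0 ≤ s + h)]
    abel

/-- `φ_h` (for `0 < h < Δ`): `φ_h(s) = φ(s + h)` on `[-Δ, -h]` and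
`φ_h(s) = 𝒟φ + f(φ)(s + h) - 𝒟φ*_{s+h} + φ(0)` on `(-h, 0]`. -/
def driverStep (φ : PhaseSpace n S.Δ) (h : ℝ) : PhaseSpace n S.Δ where
  toFun s := if (s : ℝ) ≤ -h then S.D.ext φ ((s : ℝ) + h)
    else S.D.apply φ + ((s : ℝ) + h) • S.f φ - S.D.apply (S.D.frozen φ ((s : ℝ) + h))
      + φ S.D.zeroPt
  continuous_toFun := by
    simp only [driverStep_eq]
    have h0 : Continuous fun s : Set.Icc (-S.Δ) (0 : ℝ) => (s : ℝ) + h := by fun_prop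
    have hm : Continuous fun s : Set.Icc (-S.Δ) (0 : ℝ) => max ((s : ℝ) + h) 0 := by fun_prop
    exact ((((S.D.continuous_ext φ).comp h0).add (hm.smul continuous_const)).add
      continuous_const).sub ((S.D.continuous_apply_frozen φ).comp hm)

/-- Driver's derivative `D⁺V(φ) = limsup_{h → 0⁺} (V(φ_h) - V(φ)) / h`, valued in the extended
reals. -/
def driverDeriv (V : PhaseSpace n S.Δ → ℝ) (φ : PhaseSpace n S.Δ) : EReal :=
  Filter.limsup (fun h : ℝ => (((1 / h) * (V (S.driverStep φ h) - V φ) : ℝ) : EReal)) (𝓝[>] 0)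

end NeutralSystem

end

/-! Sufficiency. `φ_h` is built so that along a solution it differs from `x_{t+h}` by `o(h)`
(`norm_driverStep_sub_le`). For locally Lipschitz `V` a bound on Driver's derivative therefore
bounds the growth of `t ↦ V(x_t)`, and Grönwall gives `a₁|𝒟x_t| ≤ V(x_t) ≤ a₂ e^{-a₃t}‖ξ₀‖`.
Stability of `𝒟` turns exponential decay of `𝒟x_t` into exponential decay of `x_t`
(`IsStable.exists_exp_decay`): over a fixed period, homogeneous solutions contract by `1/4` and the
inhomogeneity adds only a multiple of its size. The estimate is a priori, so global existence
follows by truncating `f` outside a large ball, solving the globally Lipschitz equation, and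
observing that its solution never leaves the ball.

Necessity. If solutions decay like `e^{-2μt}`, put `V(φ) = sup_{t ≥ 0} e^{μt}‖x_t‖`, where `x`
starts at `φ`. Then `‖φ‖ ≤ V(φ) ≤ M‖φ‖`, and the semigroup property gives `V(x_s) ≤ e^{-μs}V(φ)`.
Only a compact range of times matters for the Lipschitz property, which thus follows from Lipschitz
dependence on initial data.

Existence and dependence on data both use a norm weighted by `e^{-γt}`: all delays are bounded below
by some `δ > 0`, so a large `γ` makes the delayed terms small whatever the size of the `A_j`. -/

/-! ### Segments, shifts and their norms. -/

theorem continuous_segment_at {n : ℕ} (Δ : ℝ) (x : C(ℝ, EuclideanSpace ℝ (Fin n))) :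
    Continuous (segment_at Δ x) := by
  refine ContinuousMap.continuous_of_continuous_uncurry _ ?_
  change Continuous fun q : ℝ × Set.Icc (-Δ) (0 : ℝ) => x (q.1 + (q.2 : ℝ))
  fun_prop

theorem segment_at_sub {n : ℕ} (Δ : ℝ) (x y : C(ℝ, EuclideanSpace ℝ (Fin n))) (t : ℝ) :
    segment_at Δ (x - y) t = segment_at Δ x t - segment_at Δ y t := rfl

theorem segment_at_smul {n : ℕ} (Δ c : ℝ) (x : C(ℝ, EuclideanSpace ℝ (Fin n))) (t : ℝ) :
    segment_at Δ (c • x) t = c • segment_at Δ x t := rfl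

/-- The time shift `t ↦ x (t + h)`. -/
def shift {n : ℕ} (x : C(ℝ, EuclideanSpace ℝ (Fin n))) (h : ℝ) :
    C(ℝ, EuclideanSpace ℝ (Fin n)) where
  toFun t := x (t + h)
  continuous_toFun := by fun_prop

theorem segment_at_shift {n : ℕ} (Δ : ℝ) (x : C(ℝ, EuclideanSpace ℝ (Fin n))) (h t : ℝ) :
    segment_at Δ (shift x h) t = segment_at Δ x (t + h) := by
  ext1 τ
  change x (t + τ + h) = x (t + h + τ)
  congr 1
  ring

theorem norm_segment_at_le_iff {n : ℕ} {Δ : ℝ} (x : C(ℝ, EuclideanSpace ℝ (Fin n))) (t : ℝ)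
    {c : ℝ} (hc : 0 ≤ c) :
    ‖segment_at Δ x t‖ ≤ c ↔ ∀ s, t - Δ ≤ s → s ≤ t → ‖x s‖ ≤ c := by
  rw [ContinuousMap.norm_le _ hc]
  constructor
  · intro h s h1 h2
    have := h ⟨s - t, by constructor <;> linarith⟩
    simpa [segment_at] using this
  · intro h τ
    exact h _ (by linarith [τ.2.1]) (by linarith [τ.2.2])

theorem norm_le_norm_segment_at {n : ℕ} {Δ : ℝ} (x : C(ℝ, EuclideanSpace ℝ (Fin n))) {t s : ℝ}
    (h1 : t - Δ ≤ s) (h2 : s ≤ t) : ‖x s‖ ≤ ‖segment_at Δ x t‖ :=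
  (norm_segment_at_le_iff x t (norm_nonneg _)).1 le_rfl s h1 h2

/-! ### Algebra of `𝒟` and growth bounds in an exponentially weighted norm. -/

namespace DifferenceOperator

variable {n p : ℕ} (D : DifferenceOperator n p)

/-- The matrix `A_j` as an operator on Euclidean space. -/
noncomputable def coeff (j : Fin p) : EuclideanSpace ℝ (Fin n) →L[ℝ] EuclideanSpace ℝ (Fin n) :=
  Matrix.toEuclideanCLM (𝕜 := ℝ) (D.A j)

/-- The sum of the operator norms of the matrices `A_j`. -/
noncomputable def coeffNorm : ℝ := ∑ j, ‖D.coeff j‖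

theorem coeffNorm_nonneg : 0 ≤ D.coeffNorm := Finset.sum_nonneg fun _ _ => norm_nonneg _

theorem norm_sum_coeff_le (v : Fin p → EuclideanSpace ℝ (Fin n)) {c : ℝ}
    (hv : ∀ j, ‖v j‖ ≤ c) : ‖∑ j, D.coeff j (v j)‖ ≤ D.coeffNorm * c := by
  rw [coeffNorm, Finset.sum_mul]
  exact norm_sum_le_of_le _ fun j _ => (D.coeff j).le_opNorm_of_le (hv j)

theorem apply_eq (φ : PhaseSpace n D.Δ) :
    D.apply φ = φ D.zeroPt - ∑ j, D.coeff j (φ (D.delayPt j)) := rfl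

theorem apply_segment_at (x : C(ℝ, EuclideanSpace ℝ (Fin n))) (t : ℝ) :
    D.apply (segment_at D.Δ x t) = x t - ∑ j, D.coeff j (x (t - D.delay j)) := by
  simp [apply_eq, segment_at, zeroPt, delayPt, sub_eq_add_neg]

theorem apply_sub (φ ψ : PhaseSpace n D.Δ) : D.apply (φ - ψ) = D.apply φ - D.apply ψ := by
  simp only [apply_eq, ContinuousMap.sub_apply, map_sub, Finset.sum_sub_distrib]
  abel

theorem apply_smul (c : ℝ) (φ : PhaseSpace n D.Δ) : D.apply (c • φ) = c • D.apply φ := by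
  simp only [apply_eq, ContinuousMap.smul_apply, map_smul, ← Finset.smul_sum, smul_sub]

theorem norm_apply_le (φ : PhaseSpace n D.Δ) : ‖D.apply φ‖ ≤ (1 + D.coeffNorm) * ‖φ‖ := by
  rw [apply_eq, add_mul, one_mul]
  exact (norm_sub_le _ _).trans (add_le_add (φ.norm_coe_le_norm _)
    (D.norm_sum_coeff_le _ fun j => φ.norm_coe_le_norm _))

theorem norm_ext_le (φ : PhaseSpace n D.Δ) (s : ℝ) : ‖D.ext φ s‖ ≤ ‖φ‖ :=
  φ.norm_coe_le_norm _

theorem exists_delay_lower_bound : ∃ δ : ℝ, 0 < δ ∧ ∀ j, δ ≤ D.delay j := by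
  rcases isEmpty_or_nonempty (Fin p) with h | h
  · exact ⟨1, one_pos, fun j => h.elim j⟩
  · obtain ⟨j, hj⟩ := Finite.exists_min D.delay
    exact ⟨_, D.delay_pos j, hj⟩

/-- A weight exponent that makes the delayed terms and a perturbation of size `L` small. -/
theorem exists_weight (L : ℝ) : ∃ γ : ℝ, 0 < γ ∧ 8 * L ≤ γ ∧
    ∀ v : Fin p → EuclideanSpace ℝ (Fin n), ∀ c t : ℝ, 0 ≤ c →
      (∀ j, ‖v j‖ ≤ c * Real.exp (γ * (t - D.delay j))) →
      ‖∑ j, D.coeff j (v j)‖ ≤ c / 8 * Real.exp (γ * t) := by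
  obtain ⟨δ, hδ, hd⟩ := D.exists_delay_lower_bound
  have ha := D.coeffNorm_nonneg
  -- The first summand yields `exp (γ δ) ≥ 8 * coeffNorm`, so a delay of at least `δ` reduces the
  -- matrices to a factor `1/8`; the second makes integrating a Lipschitz term cost `L / γ ≤ 1/8`.
  set γ := 8 * D.coeffNorm / δ + 8 * |L| + 1 with hγ
  have h0 : 0 ≤ 8 * D.coeffNorm / δ := by positivity
  have hL := le_abs_self L
  have hL' := abs_nonneg L
  have hγ0 : 0 < γ := by positivity
  refine ⟨γ, hγ0, by linarith, fun v c t hc hv => ?_⟩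
  have h1 : D.coeffNorm * 8 ≤ Real.exp (γ * δ) := by
    have h2 : 8 * D.coeffNorm / δ * δ = 8 * D.coeffNorm := by field_simp
    have h3 : 8 * D.coeffNorm / δ * δ ≤ γ * δ := by gcongr; linarith
    linarith [Real.add_one_le_exp (γ * δ)]
  have h2 : ‖∑ j, D.coeff j (v j)‖ ≤ D.coeffNorm * (c * Real.exp (γ * (t - δ))) := by
    refine D.norm_sum_coeff_le _ fun j => (hv j).trans ?_
    gcongr
    exact hd j
  refine h2.trans ?_
  have h3 : Real.exp (γ * t) = Real.exp (γ * (t - δ)) * Real.exp (γ * δ) := by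
    rw [← Real.exp_add]; congr 1; ring
  rw [h3]
  have h4 := mul_le_mul_of_nonneg_right h1 (mul_nonneg hc (Real.exp_nonneg (γ * (t - δ))))
  linarith

/-- Weighted growth bound for functions with small `𝒟 d_t`. -/
theorem norm_le_of_apply_le {γ : ℝ} (hγ : 0 < γ)
    (hw : ∀ v : Fin p → EuclideanSpace ℝ (Fin n), ∀ c t : ℝ, 0 ≤ c →
      (∀ j, ‖v j‖ ≤ c * Real.exp (γ * (t - D.delay j))) →
      ‖∑ j, D.coeff j (v j)‖ ≤ c / 8 * Real.exp (γ * t))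
    (d : C(ℝ, EuclideanSpace ℝ (Fin n))) {G T : ℝ} (hG : 0 ≤ G) (hT : 0 ≤ T)
    (h : ∀ m : ℝ, 0 ≤ m → (∀ s, -D.Δ ≤ s → s ≤ T → ‖d s‖ ≤ m * Real.exp (γ * s)) →
      ∀ t, 0 ≤ t → t ≤ T →
        ‖D.apply (segment_at D.Δ d t)‖ ≤ G + m / 4 * Real.exp (γ * t)) {t : ℝ}
    (ht : -D.Δ ≤ t) (htT : t ≤ T) :
    ‖d t‖ ≤ (Real.exp (γ * D.Δ) + 2) * (‖segment_at D.Δ d 0‖ + G) * Real.exp (γ * t) := by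
  have hΔ := D.Δ_pos
  -- Let `m` be the weighted maximum, attained at `t₀`. For `t₀ ≤ 0` the initial segment bounds it;
  -- for `t₀ ≥ 0` the delays return `m/8` and `h` returns `m/4`, so `m ≤ G + 3m/8` and `m` is
  -- absorbed.
  obtain ⟨t₀, ht₀, hmax⟩ := (isCompact_Icc (a := -D.Δ) (b := T)).exists_isMaxOn
    ⟨0, by constructor <;> linarith⟩
    (f := fun s => ‖d s‖ * Real.exp (-(γ * s))) (by fun_prop)
  set m := ‖d t₀‖ * Real.exp (-(γ * t₀)) with hm
  have hm0 : 0 ≤ m := by positivity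
  have hle : ∀ s, -D.Δ ≤ s → s ≤ T → ‖d s‖ ≤ m * Real.exp (γ * s) := by
    intro s h1 h2
    have h3 : ‖d s‖ * Real.exp (-(γ * s)) ≤ m := hmax ⟨h1, h2⟩
    rwa [Real.exp_neg, ← div_eq_mul_inv, div_le_iff₀ (Real.exp_pos _)] at h3
  refine (hle t ht htT).trans ?_
  gcongr
  set B := ‖segment_at D.Δ d 0‖
  have hB : 0 ≤ B := norm_nonneg _
  have hE := Real.exp_pos (γ * D.Δ)
  rcases le_total t₀ 0 with h0 | h0
  · have h1 : ‖d t₀‖ ≤ B := norm_le_norm_segment_at d (by linarith [ht₀.1]) h0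
    have h2 : Real.exp (-(γ * t₀)) ≤ Real.exp (γ * D.Δ) := by
      rw [Real.exp_le_exp]; nlinarith [ht₀.1]
    calc m ≤ B * Real.exp (γ * D.Δ) := by rw [hm]; gcongr
      _ ≤ _ := by nlinarith [mul_nonneg hE.le hG]
  · have h1 := h m hm0 hle t₀ h0 ht₀.2
    rw [apply_segment_at] at h1
    have h2 := hw (fun j => d (t₀ - D.delay j)) m t₀ hm0 fun j =>
      hle _ (by linarith [D.delay_le j]) (by linarith [D.delay_pos j, ht₀.2])
    have h3 : ‖d t₀‖ ≤ G + 3 / 8 * m * Real.exp (γ * t₀) := by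
      have := norm_sub_norm_le (d t₀) (∑ j, D.coeff j (d (t₀ - D.delay j)))
      linarith
    have h4 : m ≤ (G + 3 / 8 * m * Real.exp (γ * t₀)) * Real.exp (-(γ * t₀)) := by
      rw [hm]; gcongr
    have h5 : Real.exp (γ * t₀) * Real.exp (-(γ * t₀)) = 1 := by
      rw [← Real.exp_add]; simp
    have h6 : Real.exp (-(γ * t₀)) ≤ 1 := by
      rw [Real.exp_le_one_iff]; nlinarith
    have h7 : m ≤ G + 3 / 8 * m := by
      calc m ≤ G * Real.exp (-(γ * t₀)) +
            3 / 8 * m * (Real.exp (γ * t₀) * Real.exp (-(γ * t₀))) := by linarith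
        _ ≤ G * 1 + 3 / 8 * m * 1 := by rw [h5]; gcongr
        _ = _ := by ring
    nlinarith [mul_nonneg hE.le hG, mul_nonneg hE.le hB]

end DifferenceOperator

/-! ### Global existence by a contraction in the weighted norm. -/

namespace DifferenceOperator

variable {n p : ℕ} (D : DifferenceOperator n p)

theorem norm_segment_at_le_exp (d : C(ℝ, EuclideanSpace ℝ (Fin n))) {γ c t : ℝ} (hγ : 0 ≤ γ)
    (hc : 0 ≤ c) (h : ∀ s, t - D.Δ ≤ s → s ≤ t → ‖d s‖ ≤ c * Real.exp (γ * s)) :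
    ‖segment_at D.Δ d t‖ ≤ c * Real.exp (γ * t) := by
  refine (norm_segment_at_le_iff d t (by positivity)).2 fun s h1 h2 => (h s h1 h2).trans ?_
  gcongr

theorem integral_exp_mul_le {γ t : ℝ} (hγ : 0 < γ) :
    ∫ s in (0 : ℝ)..t, Real.exp (γ * s) ≤ Real.exp (γ * t) / γ := by
  rw [intervalIntegral.integral_comp_mul_left (fun s => Real.exp s) hγ.ne', integral_exp,
    smul_eq_mul, div_eq_inv_mul]
  have : 0 ≤ Real.exp (γ * 0) := (Real.exp_pos _).le
  gcongr
  linarith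

/-- The right-hand side of the integrated equation
`x(t) - ξ(0) = ∑ j, A_j x(t - Δ_j) + 𝒟 ξ - ξ(0) + ∫₀ᵗ F(x_s) ds`. -/
noncomputable def picard (F : PhaseSpace n D.Δ → EuclideanSpace ℝ (Fin n))
    (ξ : PhaseSpace n D.Δ) (x : C(ℝ, EuclideanSpace ℝ (Fin n))) (t : ℝ) :
    EuclideanSpace ℝ (Fin n) :=
  ∑ j, D.coeff j (x (t - D.delay j)) + (D.apply ξ - ξ D.zeroPt)
    + ∫ s in (0 : ℝ)..t, F (segment_at D.Δ x s)

theorem continuous_picard {F : PhaseSpace n D.Δ → EuclideanSpace ℝ (Fin n)} (hF : Continuous F)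
    (ξ : PhaseSpace n D.Δ) (x : C(ℝ, EuclideanSpace ℝ (Fin n))) :
    Continuous (D.picard F ξ x) := by
  have h1 : Continuous fun t : ℝ => ∫ s in (0 : ℝ)..t, F (segment_at D.Δ x s) :=
    intervalIntegral.continuous_primitive
      (fun a b => (hF.comp (continuous_segment_at _ x)).intervalIntegrable a b) 0
  unfold picard
  fun_prop

/-- One half of `c / 4` comes from the delayed terms, the other from `∫ L c e^{γs} ds ≤ (L/γ) c
e^{γt}`. -/
theorem norm_picard_sub_le {F : PhaseSpace n D.Δ → EuclideanSpace ℝ (Fin n)} {L γ : ℝ}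
    (hF : Continuous F) (hL : 0 ≤ L) (hFL : ∀ φ ψ, ‖F φ - F ψ‖ ≤ L * ‖φ - ψ‖)
    (hγ : 0 < γ) (hγL : 8 * L ≤ γ)
    (hw : ∀ v : Fin p → EuclideanSpace ℝ (Fin n), ∀ c t : ℝ, 0 ≤ c →
      (∀ j, ‖v j‖ ≤ c * Real.exp (γ * (t - D.delay j))) →
      ‖∑ j, D.coeff j (v j)‖ ≤ c / 8 * Real.exp (γ * t))
    (ξ : PhaseSpace n D.Δ) (x y : C(ℝ, EuclideanSpace ℝ (Fin n))) {c : ℝ} (hc : 0 ≤ c)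
    (h : ∀ s, -D.Δ ≤ s → ‖x s - y s‖ ≤ c * Real.exp (γ * s)) {t : ℝ} (ht : 0 ≤ t) :
    ‖D.picard F ξ x t - D.picard F ξ y t‖ ≤ c / 4 * Real.exp (γ * t) := by
  have hx : Continuous fun s => F (segment_at D.Δ x s) := hF.comp (continuous_segment_at D.Δ x)
  have hy : Continuous fun s => F (segment_at D.Δ y s) := hF.comp (continuous_segment_at D.Δ y)
  have h1 : D.picard F ξ x t - D.picard F ξ y t =
      ∑ j, D.coeff j (x (t - D.delay j) - y (t - D.delay j)) +
      ∫ s in (0 : ℝ)..t, (F (segment_at D.Δ x s) - F (segment_at D.Δ y s)) := by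
    rw [intervalIntegral.integral_sub (hx.intervalIntegrable 0 t) (hy.intervalIntegrable 0 t)]
    simp only [picard, map_sub, Finset.sum_sub_distrib]
    abel
  have h2 := hw (fun j => x (t - D.delay j) - y (t - D.delay j)) c t hc fun j =>
    h _ (by linarith [D.delay_le j])
  have h3 : ‖∫ s in (0 : ℝ)..t, (F (segment_at D.Δ x s) - F (segment_at D.Δ y s))‖ ≤
      ∫ s in (0 : ℝ)..t, L * c * Real.exp (γ * s) := by
    refine intervalIntegral.norm_integral_le_of_norm_le ht
      (Eventually.of_forall fun s hs => (hFL _ _).trans ?_)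
      (Continuous.intervalIntegrable (by fun_prop) _ _)
    rw [mul_assoc]
    gcongr
    rw [← segment_at_sub]
    exact D.norm_segment_at_le_exp (x - y) hγ.le hc fun r h1 _ => h r (by linarith [hs.1])
  have h4 : L * c * (Real.exp (γ * t) / γ) ≤ c / 8 * Real.exp (γ * t) := by
    have : L / γ ≤ 1 / 8 := by rw [div_le_iff₀ hγ]; linarith
    have := mul_le_mul_of_nonneg_right this (mul_nonneg hc (Real.exp_nonneg (γ * t)))
    calc _ = L / γ * (c * Real.exp (γ * t)) := by ring
      _ ≤ _ := by linarith
  have h5 : ∫ s in (0 : ℝ)..t, L * c * Real.exp (γ * s) ≤ L * c * (Real.exp (γ * t) / γ) := by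
    rw [intervalIntegral.integral_const_mul]
    have := integral_exp_mul_le (t := t) hγ
    gcongr
  rw [h1]
  refine (norm_add_le _ _).trans ?_
  linarith

/-- The candidate solution `ξ` for `t ≤ 0`, `ξ(0) - v(0) + exp(γ t) v(t)` for `t ≥ 0`. -/
noncomputable def trial (ξ : PhaseSpace n D.Δ) (γ : ℝ)
    (v : BoundedContinuousFunction ℝ (EuclideanSpace ℝ (Fin n))) :
    C(ℝ, EuclideanSpace ℝ (Fin n)) where
  toFun t := D.ext ξ t + Real.exp (γ * max t 0) • v (max t 0) - v 0
  continuous_toFun := by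
    have := D.continuous_ext ξ
    have := v.continuous
    fun_prop

theorem trial_apply (ξ : PhaseSpace n D.Δ) (γ : ℝ)
    (v : BoundedContinuousFunction ℝ (EuclideanSpace ℝ (Fin n))) (t : ℝ) :
    D.trial ξ γ v t = D.ext ξ t + Real.exp (γ * max t 0) • v (max t 0) - v 0 := rfl

theorem trial_of_nonpos (ξ : PhaseSpace n D.Δ) (γ : ℝ)
    (v : BoundedContinuousFunction ℝ (EuclideanSpace ℝ (Fin n))) {t : ℝ} (ht : t ≤ 0) :
    D.trial ξ γ v t = D.ext ξ t := by
  simp [trial_apply, max_eq_right ht]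

theorem segment_at_trial_zero (ξ : PhaseSpace n D.Δ) (γ : ℝ)
    (v : BoundedContinuousFunction ℝ (EuclideanSpace ℝ (Fin n))) :
    segment_at D.Δ (D.trial ξ γ v) 0 = ξ := by
  ext1 τ
  change D.trial ξ γ v (0 + τ) = ξ τ
  rw [zero_add, trial_of_nonpos _ _ _ _ τ.2.2, D.ext_of_mem ξ τ.2]

/-- The factor `2` pays for the correction `v 0`, which makes every trial function continuous at
`0`. Together with the `1/4` of `norm_picard_sub_le` it leaves a contraction constant `1/2`. -/
theorem norm_trial_sub_le (ξ : PhaseSpace n D.Δ) {γ : ℝ} (hγ : 0 ≤ γ)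
    (v w : BoundedContinuousFunction ℝ (EuclideanSpace ℝ (Fin n))) (t : ℝ) :
    ‖D.trial ξ γ v t - D.trial ξ γ w t‖ ≤ 2 * ‖v - w‖ * Real.exp (γ * t) := by
  rcases le_total t 0 with ht | ht
  · rw [trial_of_nonpos _ _ _ _ ht, trial_of_nonpos _ _ _ _ ht, sub_self, norm_zero]
    positivity
  · have h1 : D.trial ξ γ v t - D.trial ξ γ w t =
        Real.exp (γ * t) • (v - w) t - (v - w) 0 := by
      simp only [trial_apply, max_eq_left ht, BoundedContinuousFunction.sub_apply, smul_sub]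
      abel
    have h2 : 1 ≤ Real.exp (γ * t) := Real.one_le_exp (by positivity)
    have h3 := (v - w).norm_coe_le_norm t
    have h4 := (v - w).norm_coe_le_norm 0
    rw [h1]
    refine (norm_sub_le _ _).trans ?_
    rw [norm_smul, Real.norm_eq_abs, Real.abs_exp]
    nlinarith [norm_nonneg (v - w), Real.exp_pos (γ * t)]

/-- Global existence for `d/dt 𝒟 x_t = F(x_t)` with globally Lipschitz `F`. -/
theorem exists_solution {F : PhaseSpace n D.Δ → EuclideanSpace ℝ (Fin n)} {L : ℝ}
    (hL : 0 ≤ L) (hFL : ∀ φ ψ, ‖F φ - F ψ‖ ≤ L * ‖φ - ψ‖) (ξ : PhaseSpace n D.Δ) :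
    ∃ x : C(ℝ, EuclideanSpace ℝ (Fin n)), segment_at D.Δ x 0 = ξ ∧
      ∀ t : ℝ, 0 ≤ t → HasDerivWithinAt (fun s : ℝ => D.apply (segment_at D.Δ x s))
        (F (segment_at D.Δ x t)) (Set.Ici 0) t := by
  have hF : Continuous F := by
    refine (LipschitzWith.of_dist_le_mul (K := ⟨L, hL⟩) fun φ ψ => ?_).continuous
    rw [dist_eq_norm, dist_eq_norm]
    exact hFL φ ψ
  obtain ⟨γ, hγ, hγL, hw⟩ := D.exists_weight L
  have hpic := fun x y c hc h t ht => D.norm_picard_sub_le hF hL hFL hγ hγL hw ξ x y (c := c) hc h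
    (t := t) ht
  have hcont : ∀ v, Continuous fun t : ℝ =>
      Real.exp (-(γ * max t 0)) • D.picard F ξ (D.trial ξ γ v) (max t 0) := fun v => by
    have := D.continuous_picard hF ξ (D.trial ξ γ v)
    fun_prop
  have hsub : ∀ v w t, ‖Real.exp (-(γ * max t 0)) • D.picard F ξ (D.trial ξ γ v) (max t 0) -
      Real.exp (-(γ * max t 0)) • D.picard F ξ (D.trial ξ γ w) (max t 0)‖ ≤
        1 / 2 * ‖v - w‖ := fun v w t => by
    have h := hpic _ _ (2 * ‖v - w‖) (by positivity)
      (fun s _ => D.norm_trial_sub_le ξ hγ.le v w s) (max t 0) (le_max_right _ _)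
    rw [← smul_sub, norm_smul, Real.norm_eq_abs, Real.abs_exp, Real.exp_neg, inv_mul_le_iff₀
      (Real.exp_pos _)]
    linarith
  -- Boundedness of the image of `v = 0`, by comparison with the zero path, for which `picard` grows
  -- only linearly. With `hsub` it makes the fixed-point map act on bounded functions.
  have hbase : ∃ C, ∀ t,
      ‖Real.exp (-(γ * max t 0)) • D.picard F ξ (D.trial ξ γ 0) (max t 0)‖ ≤ C := by
    refine ⟨‖ξ‖ * Real.exp (γ * D.Δ) / 4 + (‖D.apply ξ - ξ D.zeroPt‖ + ‖F 0‖ / γ), fun t => ?_⟩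
    have ht : 0 ≤ max t 0 := le_max_right _ _
    generalize max t 0 = r at ht
    have h := hpic (D.trial ξ γ 0) 0 (‖ξ‖ * Real.exp (γ * D.Δ)) (by positivity) (fun s hs => by
      have h1 : D.trial ξ γ 0 s = D.ext ξ s := by simp [trial_apply]
      have h2 : 1 ≤ Real.exp (γ * D.Δ) * Real.exp (γ * s) := by
        rw [← Real.exp_add]; exact Real.one_le_exp (by nlinarith)
      rw [h1, ContinuousMap.zero_apply, sub_zero]
      nlinarith [D.norm_ext_le ξ s, norm_nonneg ξ]) r ht
    have h0 : D.picard F ξ 0 r = (D.apply ξ - ξ D.zeroPt) + r • F 0 := by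
      have : ∀ s, segment_at D.Δ (0 : C(ℝ, EuclideanSpace ℝ (Fin n))) s = 0 := fun _ => rfl
      simp [picard, this]
    have h1 : ‖D.picard F ξ 0 r‖ ≤
        (‖D.apply ξ - ξ D.zeroPt‖ + ‖F 0‖ / γ) * Real.exp (γ * r) := by
      rw [h0]
      refine (norm_add_le _ _).trans ?_
      rw [norm_smul, Real.norm_of_nonneg ht, add_mul]
      have h2 : 1 ≤ Real.exp (γ * r) := Real.one_le_exp (by positivity)
      refine add_le_add (le_mul_of_one_le_right (norm_nonneg _) h2) ?_
      rw [div_mul_eq_mul_div, le_div_iff₀ hγ]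
      have h3 := Real.add_one_le_exp (γ * r)
      nlinarith [mul_le_mul_of_nonneg_left h3 (norm_nonneg (F 0)), norm_nonneg (F 0)]
    rw [norm_smul, Real.norm_eq_abs, Real.abs_exp, Real.exp_neg, inv_mul_le_iff₀ (Real.exp_pos _)]
    have h2 := norm_le_norm_sub_add (D.picard F ξ (D.trial ξ γ 0) r) (D.picard F ξ 0 r)
    linarith
  obtain ⟨C, hC⟩ := hbase
  set P : BoundedContinuousFunction ℝ (EuclideanSpace ℝ (Fin n)) →
      BoundedContinuousFunction ℝ (EuclideanSpace ℝ (Fin n)) := fun v =>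
    BoundedContinuousFunction.ofNormedAddCommGroup _ (hcont v) (1 / 2 * ‖v - 0‖ + C) fun t =>
      (norm_le_norm_sub_add _ _).trans (add_le_add (hsub v 0 t) (hC t)) with hP
  have hcontr : ContractingWith (1 / 2) P := by
    refine ⟨by rw [← NNReal.coe_lt_coe]; norm_num, LipschitzWith.of_dist_le_mul fun v w => ?_⟩
    rw [dist_eq_norm, dist_eq_norm]
    refine (BoundedContinuousFunction.norm_le (by positivity)).2 fun t => ?_
    simpa [hP] using hsub v w t
  obtain ⟨v, hv, -⟩ := hcontr.exists_fixedPoint 0 (edist_ne_top _ _)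
  set x := D.trial ξ γ v with hx
  have hx0 : segment_at D.Δ x 0 = ξ := D.segment_at_trial_zero ξ γ v
  have hvt : ∀ t, 0 ≤ t → Real.exp (γ * t) • v t = D.picard F ξ x t := fun t ht => by
    have h : v t = Real.exp (-(γ * max t 0)) • D.picard F ξ x (max t 0) :=
      (DFunLike.congr_fun hv.symm t :)
    rw [max_eq_left ht] at h
    rw [h, smul_smul, ← Real.exp_add, add_neg_cancel, Real.exp_zero, one_smul]
  -- At time `0` the delayed values are those of `ξ`, so `picard` vanishes by the definition of `𝒟
  -- ξ`; the correction in `trial` disappears at the fixed point.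
  have hv0 : v 0 = 0 := by
    have h := hvt 0 le_rfl
    have h1 : ∀ j, x (-D.delay j) = ξ (D.delayPt j) := fun j => by
      rw [hx, trial_of_nonpos _ _ _ _ (by linarith [D.delay_pos j])]
      exact D.ext_of_mem ξ (D.delayPt j).2
    simpa [picard, h1, apply_eq] using h
  have hint : ∀ t, 0 ≤ t → D.apply (segment_at D.Δ x t) =
      D.apply ξ + ∫ s in (0 : ℝ)..t, F (segment_at D.Δ x s) := fun t ht => by
    have h1 : x t = ξ D.zeroPt + D.picard F ξ x t := by
      rw [← hvt t ht, hx, trial_apply, max_eq_left ht, hv0, D.ext_of_nonneg ξ ht, sub_zero]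
    rw [apply_segment_at, h1, picard]
    abel
  refine ⟨x, hx0, fun t ht => ?_⟩
  have hc := hF.comp (continuous_segment_at D.Δ x)
  have hd : HasDerivAt (fun t => D.apply ξ + ∫ s in (0 : ℝ)..t, F (segment_at D.Δ x s))
      (F (segment_at D.Δ x t)) t :=
    (intervalIntegral.integral_hasDerivAt_right (hc.intervalIntegrable 0 t)
      (hc.stronglyMeasurableAtFilter _ _) hc.continuousAt).const_add _
  exact hd.hasDerivWithinAt.congr (fun s hs => hint s hs) (hint t ht)

end DifferenceOperator

/-! ### Stability of `𝒟`: decay of `𝒟 y_t` implies decay of `y_t`. -/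

namespace DifferenceOperator

variable {n p : ℕ} (D : DifferenceOperator n p)

theorem continuous_apply : Continuous D.apply := by
  have h : ∀ s, Continuous fun φ : PhaseSpace n D.Δ => φ s := fun s =>
    continuous_eval_const s
  have h' : D.apply = fun φ => φ D.zeroPt - ∑ j, D.coeff j (φ (D.delayPt j)) := rfl
  rw [h']
  fun_prop

theorem continuous_apply_segment_at (x : C(ℝ, EuclideanSpace ℝ (Fin n))) :
    Continuous fun t => D.apply (segment_at D.Δ x t) :=
  D.continuous_apply.comp (continuous_segment_at _ x)

/-- Stability speaks only of homogeneous solutions, so general functions are compared with one of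
these. With zero right-hand side `𝒟 z_t` stays constant. -/
theorem exists_homogeneousSolution {ψ : PhaseSpace n D.Δ} (hψ : D.apply ψ = 0) :
    ∃ z, D.IsHomogeneousSolution z ∧ segment_at D.Δ z 0 = ψ := by
  obtain ⟨z, h0, hz⟩ := D.exists_solution (F := fun _ => 0) le_rfl (by simp) ψ
  refine ⟨z, fun t ht => ?_, h0⟩
  have h := constant_of_has_deriv_right_zero (a := 0) (b := t)
    (D.continuous_apply_segment_at z).continuousOn
    (fun s hs => (hz s hs.1).mono (Ici_subset_Ici.2 hs.1)) t ⟨ht, le_rfl⟩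
  rw [h, h0, hψ]

/-- A right inverse of `𝒟`. -/
theorem exists_apply_eq (v : EuclideanSpace ℝ (Fin n)) :
    ∃ φ : PhaseSpace n D.Δ, D.apply φ = v ∧ ‖φ‖ ≤ ‖v‖ := by
  obtain ⟨δ, hδ, hd⟩ := D.exists_delay_lower_bound
  -- A hat with peak `v` at `0` that vanishes to the left of `-δ`, hence at every delay point: `𝒟`
  -- sees only its value at `0`.
  refine ⟨⟨fun τ => max (1 + (τ : ℝ) / δ) 0 • v, by fun_prop⟩, ?_, ?_⟩
  · have h : ∀ j, max (1 + -D.delay j / δ) 0 = 0 := fun j => by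
      refine max_eq_right ?_
      have := (one_le_div hδ).2 (hd j)
      rw [neg_div]
      linarith
    simp [apply_eq, zeroPt, delayPt, h]
  · refine (ContinuousMap.norm_le _ (norm_nonneg v)).2 fun τ => ?_
    change ‖max (1 + (τ : ℝ) / δ) 0 • v‖ ≤ ‖v‖
    rw [norm_smul, Real.norm_of_nonneg (le_max_right _ _)]
    refine mul_le_of_le_one_left (norm_nonneg v) (max_le ?_ zero_le_one)
    have := div_nonpos_of_nonpos_of_nonneg τ.2.2 hδ.le
    linarith

variable {D}

/-- Uniform attraction becomes a linear contraction by homogeneity: if it failed, rescaling the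
solution to norm `b/8` at the final time would make its initial norm less than `b/2`, against
attraction of the `b`-ball to norms below `b/8`. -/
theorem IsStable.exists_norm_le (hD : D.IsStable) :
    ∃ T : ℝ, 0 < T ∧ ∀ y, D.IsHomogeneousSolution y →
      ‖segment_at D.Δ y T‖ ≤ 1 / 4 * ‖segment_at D.Δ y 0‖ := by
  obtain ⟨b, hb, h⟩ := hD.2
  obtain ⟨T, hT, h⟩ := h (b / 8) (by positivity)
  refine ⟨T + 1, by linarith, fun y hy => ?_⟩
  by_contra! hlt
  set N := ‖segment_at D.Δ y (T + 1)‖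
  have hN : 0 < N := lt_of_le_of_lt (by positivity) hlt
  have hc : 0 < b / (8 * N) := by positivity
  have h1 := h ((b / (8 * N)) • y)
    (fun t ht => by rw [segment_at_smul, apply_smul, hy t ht, smul_zero])
  simp only [segment_at_smul, norm_smul, Real.norm_of_nonneg hc.le] at h1
  have h2 : b / (8 * N) * N = b / 8 := by field_simp
  have h3 := h1 (by nlinarith) (T + 1) (by linarith)
  linarith

/-- One step of the decay of solutions of `𝒟 y_t = g(t)`, and a bound within that step. -/
theorem IsStable.exists_step (hD : D.IsStable) :
    ∃ T C : ℝ, 0 < T ∧ 1 ≤ C ∧ ∀ (y : C(ℝ, EuclideanSpace ℝ (Fin n))) (G b : ℝ), 0 ≤ b → b ≤ T →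
      (∀ t, 0 ≤ t → t ≤ b → ‖D.apply (segment_at D.Δ y t)‖ ≤ G) →
      ‖segment_at D.Δ y b‖ ≤ C * (‖segment_at D.Δ y 0‖ + G) ∧
      (b = T → ‖segment_at D.Δ y b‖ ≤ 1 / 4 * ‖segment_at D.Δ y 0‖ + C * G) := by
  obtain ⟨T, hT, hz⟩ := hD.exists_norm_le
  obtain ⟨γ, hγ, -, hw⟩ := D.exists_weight 0
  have hΔ := D.Δ_pos
  set C₀ := Real.exp (γ * D.Δ) + 2 with hC₀
  have hC₀0 : 0 < C₀ := by positivity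
  have hcrude : ∀ (y : C(ℝ, EuclideanSpace ℝ (Fin n))) (G b : ℝ), 0 ≤ b → b ≤ T →
      (∀ t, 0 ≤ t → t ≤ b → ‖D.apply (segment_at D.Δ y t)‖ ≤ G) →
      ‖segment_at D.Δ y b‖ ≤ C₀ * Real.exp (γ * T) * (‖segment_at D.Δ y 0‖ + G) := by
    intro y G b hb hbT hy
    have hG : 0 ≤ G := (norm_nonneg _).trans (hy 0 le_rfl hb)
    refine (D.norm_segment_at_le_exp y hγ.le (c := C₀ * (‖segment_at D.Δ y 0‖ + G))
      (by positivity) fun s h1 h2 => ?_).trans ?_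
    · exact D.norm_le_of_apply_le hγ hw y hG hb
        (fun m hm _ t h3 h4 => (hy t h3 h4).trans (le_add_of_nonneg_right (by positivity)))
        (by linarith) h2
    · have : Real.exp (γ * b) ≤ Real.exp (γ * T) := by gcongr
      calc _ ≤ C₀ * (‖segment_at D.Δ y 0‖ + G) * Real.exp (γ * T) := by gcongr
        _ = _ := by ring
  have hE := Real.exp_pos (γ * T)
  have hCE := mul_pos hC₀0 hE
  refine ⟨T, 1 + 2 * (C₀ * Real.exp (γ * T)), hT, by linarith, fun y G b hb hbT hy => ?_⟩
  have hG : 0 ≤ G := (norm_nonneg _).trans (hy 0 le_rfl hb)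
  refine ⟨(hcrude y G b hb hbT hy).trans ?_, ?_⟩
  · gcongr
    linarith
  · rintro rfl
    -- Subtracting a preimage `φ` of `𝒟 y_0`, of norm at most `G`, puts the initial segment into the
    -- kernel of `𝒟`. The homogeneous solution `z` from there contracts, while `y - z` starts at `φ`
    -- and obeys the crude bound.
    obtain ⟨φ, hφ, hφn⟩ := D.exists_apply_eq (D.apply (segment_at D.Δ y 0))
    have hφG : ‖φ‖ ≤ G := hφn.trans (hy 0 le_rfl hb)
    obtain ⟨z, hzs, hz0⟩ := D.exists_homogeneousSolution (ψ := segment_at D.Δ y 0 - φ)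
      (by rw [apply_sub, hφ, sub_self])
    have h1 := hz z hzs
    have h2 := hcrude (y - z) G b hb le_rfl fun t h3 h4 => by
      rw [segment_at_sub, apply_sub, hzs t h3, sub_zero]
      exact hy t h3 h4
    rw [segment_at_sub, segment_at_sub, hz0, sub_sub_cancel] at h2
    rw [hz0] at h1
    have h3 := norm_le_norm_sub_add (segment_at D.Δ y b) (segment_at D.Δ z b)
    have h4 := norm_sub_le (segment_at D.Δ y 0) φ
    nlinarith

/-- If `𝒟` is stable, then exponential decay of `𝒟 y_t` forces exponential decay of `y_t`. -/
theorem IsStable.exists_exp_decay (hD : D.IsStable) {a : ℝ} (ha : 0 < a) :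
    ∃ K lam : ℝ, 0 < K ∧ 0 < lam ∧ ∀ (y : C(ℝ, EuclideanSpace ℝ (Fin n))) (G b : ℝ),
      (∀ t, 0 ≤ t → t ≤ b → ‖D.apply (segment_at D.Δ y t)‖ ≤ G * Real.exp (-a * t)) →
      ∀ t, 0 ≤ t → t ≤ b →
        ‖segment_at D.Δ y t‖ ≤ K * (‖segment_at D.Δ y 0‖ + G) * Real.exp (-lam * t) := by
  obtain ⟨T, C, hT, hC, hstep⟩ := hD.exists_step
  -- This rate loses at most a factor `1/2` per period, whereas a step contracts by `1/4`; the
  -- margin pays for the inhomogeneity.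
  set lam := min a (1 / (2 * T)) with hlam
  have hlam0 : 0 < lam := lt_min ha (by positivity)
  have hlamT : lam * T ≤ 1 / 2 := by
    calc lam * T ≤ 1 / (2 * T) * T := by gcongr; exact min_le_right _ _
      _ = 1 / 2 := by field_simp
  have hhalf : 1 / 2 ≤ Real.exp (-lam * T) := by
    have := Real.add_one_le_exp (-lam * T)
    linarith
  refine ⟨2 * (C * (4 * C + 1)), lam, by positivity, hlam0, fun y G b hy t ht htb => ?_⟩
  have hG : 0 ≤ G := by
    have := (norm_nonneg _).trans (hy 0 le_rfl (ht.trans htb))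
    simpa using this
  set Y := ‖segment_at D.Δ y 0‖ with hY
  have hY0 : 0 ≤ Y := norm_nonneg _
  have hshift : ∀ k : ℕ, ∀ r, k * T + r ≤ b → ∀ s, 0 ≤ s → s ≤ r →
      ‖D.apply (segment_at D.Δ (shift y (k * T)) s)‖ ≤ G * Real.exp (-lam * (k * T)) := by
    intro k r hk s h1 h2
    have hkT : 0 ≤ k * T := by positivity
    rw [segment_at_shift]
    refine (hy _ (by positivity) (by linarith)).trans ?_
    have h3 : lam ≤ a := min_le_left _ _
    have h4 : -a * (s + k * T) ≤ -lam * (k * T) := by nlinarith [mul_nonneg ha.le h1]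
    gcongr
  -- The constant `4C` closes the induction: `(1/4) * 4C + C = (1/2) * 4C`.
  have hk : ∀ k : ℕ, k * T ≤ b →
      ‖segment_at D.Δ y (k * T)‖ ≤ Real.exp (-lam * (k * T)) * (Y + 4 * C * G) := by
    intro k
    induction k with
    | zero =>
      intro _
      simp only [Nat.cast_zero, zero_mul, mul_zero, Real.exp_zero, one_mul, ← hY]
      nlinarith
    | succ k ih =>
      intro hkb
      have hkb' : k * T + T ≤ b := by push_cast at hkb; linarith
      have h1 := (hstep (shift y (k * T)) (G * Real.exp (-lam * (k * T))) T hT.le le_rfl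
        (hshift k T hkb')).2 rfl
      rw [segment_at_shift, segment_at_shift, zero_add] at h1
      have h2 := ih (by linarith)
      have h3 : Real.exp (-lam * ((k + 1 : ℕ) * T)) =
          Real.exp (-lam * (k * T)) * Real.exp (-lam * T) := by
        rw [← Real.exp_add]; congr 1; push_cast; ring
      have h4 : ((k + 1 : ℕ) : ℝ) * T = T + k * T := by push_cast; ring
      rw [h3, h4]
      set E := Real.exp (-lam * (k * T))
      have hE : 0 < E := Real.exp_pos _
      have h5 : E * (1 / 2) * (Y + 4 * C * G) ≤
          E * Real.exp (-lam * T) * (Y + 4 * C * G) := by gcongr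
      have h6 : 0 ≤ E * Y := by positivity
      linarith
  set k := ⌊t / T⌋₊ with hkdef
  have h1 : k * T ≤ t := by
    rw [← le_div_iff₀ hT]; exact Nat.floor_le (by positivity)
  have h2 : t - k * T ≤ T := by
    have h3 := Nat.lt_floor_add_one (t / T)
    rw [div_lt_iff₀ hT] at h3
    linarith
  have h3 := (hstep (shift y (k * T)) (G * Real.exp (-lam * (k * T))) (t - k * T)
    (by linarith) h2 (hshift k _ (by linarith))).1
  rw [segment_at_shift, segment_at_shift, zero_add, sub_add_cancel] at h3
  have h4 := hk k (by linarith)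
  have h5 : Real.exp (-lam * (k * T)) ≤ 2 * Real.exp (-lam * t) := by
    have h6 : Real.exp (-lam * t) = Real.exp (-lam * (k * T)) * Real.exp (-lam * (t - k * T)) := by
      rw [← Real.exp_add]; congr 1; ring
    have h7 : Real.exp (-lam * T) ≤ Real.exp (-lam * (t - k * T)) := by
      rw [Real.exp_le_exp]; nlinarith
    rw [h6]
    nlinarith [Real.exp_pos (-lam * (k * T))]
  calc ‖segment_at D.Δ y t‖
      ≤ C * (Real.exp (-lam * (k * T)) * (Y + 4 * C * G) + G * Real.exp (-lam * (k * T))) := by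
        refine h3.trans ?_
        gcongr
    _ = C * (Y + (4 * C + 1) * G) * Real.exp (-lam * (k * T)) := by ring
    _ ≤ C * ((4 * C + 1) * Y + (4 * C + 1) * G) * (2 * Real.exp (-lam * t)) := by
        gcongr
        nlinarith
    _ = _ := by ring

end DifferenceOperator

/-! ### Truncation of the right-hand side. -/

/-- A map that is Lipschitz on bounded sets agrees on a ball with a globally Lipschitz map. -/
theorem LipschitzOnBoundedSets.exists_truncation {n : ℕ} {Δ : ℝ}
    {f : PhaseSpace n Δ → EuclideanSpace ℝ (Fin n)} (hf : LipschitzOnBoundedSets f)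
    (hf0 : f 0 = 0) {R : ℝ} (hR : 0 < R) :
    ∃ (F : PhaseSpace n Δ → EuclideanSpace ℝ (Fin n)) (L : ℝ), 0 ≤ L ∧
      (∀ φ ψ, ‖F φ - F ψ‖ ≤ L * ‖φ - ψ‖) ∧ ∀ φ, ‖φ‖ ≤ R → F φ = f φ := by
  obtain ⟨L, hL, h⟩ := hf (R + 1) (by positivity)
  have hB : ∀ φ : PhaseSpace n Δ, ‖φ‖ ≤ R + 1 → ‖f φ‖ ≤ L * (R + 1) := fun φ hφ => by
    have := h φ 0 hφ (by simp; positivity)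
    rw [hf0, sub_zero, sub_zero] at this
    exact this.trans (by gcongr)
  set χ : PhaseSpace n Δ → ℝ := fun φ => max 0 (min 1 (R + 1 - ‖φ‖)) with hχ
  have hχ0 : ∀ φ, 0 ≤ χ φ := fun φ => le_max_left _ _
  have hχ1 : ∀ φ, χ φ ≤ 1 := fun φ => max_le zero_le_one (min_le_left _ _)
  have hχout : ∀ φ, R + 1 ≤ ‖φ‖ → χ φ = 0 := fun φ hφ =>
    max_eq_left ((min_le_right _ _).trans (by linarith))
  have hχL : ∀ φ ψ, |χ φ - χ ψ| ≤ ‖φ - ψ‖ := fun φ ψ => by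
    have h1 : |χ φ - χ ψ| ≤ |min 1 (R + 1 - ‖φ‖) - min 1 (R + 1 - ‖ψ‖)| := by
      have := abs_max_sub_max_le_max 0 (min 1 (R + 1 - ‖φ‖)) 0 (min 1 (R + 1 - ‖ψ‖))
      simpa [hχ] using this
    have h2 := abs_min_sub_min_le_max 1 (R + 1 - ‖φ‖) 1 (R + 1 - ‖ψ‖)
    rw [sub_self, abs_zero, max_eq_right (abs_nonneg _)] at h2
    have h3 : |R + 1 - ‖φ‖ - (R + 1 - ‖ψ‖)| = |‖φ‖ - ‖ψ‖| := by
      rw [abs_sub_comm ‖φ‖]; congr 1; ring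
    exact h1.trans (h2.trans (h3.le.trans (abs_norm_sub_norm_le φ ψ)))
  -- One point in the larger ball is enough: `f φ` is bounded there since `f 0 = 0`, and if `ψ` lies
  -- outside then `χ ψ = 0` removes the term containing `f ψ`.
  have key : ∀ φ ψ : PhaseSpace n Δ, ‖φ‖ ≤ R + 1 →
      ‖χ φ • f φ - χ ψ • f ψ‖ ≤ (L + L * (R + 1)) * ‖φ - ψ‖ := by
    intro φ ψ hφ
    have hd : χ φ • f φ - χ ψ • f ψ = χ ψ • (f φ - f ψ) + (χ φ - χ ψ) • f φ := by
      rw [smul_sub, sub_smul]; abel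
    rw [hd]
    refine (norm_add_le _ _).trans ?_
    rw [norm_smul, norm_smul, Real.norm_of_nonneg (hχ0 ψ), Real.norm_eq_abs, add_mul]
    refine add_le_add ?_ ?_
    · rcases le_total ‖ψ‖ (R + 1) with hψ | hψ
      · exact (mul_le_of_le_one_left (norm_nonneg _) (hχ1 ψ)).trans (h φ ψ hφ hψ)
      · rw [hχout ψ hψ, zero_mul]
        positivity
    · rw [mul_comm]
      exact mul_le_mul (hB φ hφ) (hχL φ ψ) (abs_nonneg _) (by positivity)
  refine ⟨fun φ => χ φ • f φ, L + L * (R + 1), by positivity, fun φ ψ => ?_, fun φ hφ => ?_⟩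
  · rcases le_total ‖φ‖ (R + 1) with hφ | hφ
    · exact key φ ψ hφ
    · rcases le_total ‖ψ‖ (R + 1) with hψ | hψ
      · rw [norm_sub_rev, norm_sub_rev φ]
        exact key ψ φ hψ
      · simp only [hχout φ hφ, hχout ψ hψ, zero_smul, sub_zero, norm_zero]
        positivity
  · have : χ φ = 1 := by
      simp only [hχ]
      rw [min_eq_left (by linarith), max_eq_right zero_le_one]
    simp only [this, one_smul]

/-! ### Driver's derivative along solutions, and sufficiency of the Lyapunov condition. -/

namespace NeutralSystem

variable {n p : ℕ} (S : NeutralSystem n p)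

theorem ext_segment_at (x : C(ℝ, EuclideanSpace ℝ (Fin n))) (t : ℝ) {s : ℝ}
    (hs : s ∈ Icc (-S.Δ) 0) : S.D.ext (segment_at S.Δ x t) s = x (t + s) :=
  S.D.ext_of_mem _ hs

/-- If `𝒟 x_s` has right derivative `f(x_t)` at `t`, then `(x_t)_h` is `x_{t+h}` up to `o(h)`. -/
theorem norm_driverStep_sub_le {x : C(ℝ, EuclideanSpace ℝ (Fin n))} {t : ℝ}
    (hx : HasDerivWithinAt (fun s : ℝ => S.D.apply (segment_at S.Δ x s))
      (S.f (segment_at S.Δ x t)) (Ici t) t) {ε : ℝ} (hε : 0 < ε) :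
    ∀ᶠ h in 𝓝[>] (0 : ℝ),
      ‖S.driverStep (segment_at S.Δ x t) h - segment_at S.Δ x (t + h)‖ ≤ ε * h := by
  obtain ⟨δ, hδ, hd⟩ := S.D.exists_delay_lower_bound
  have h1 := (hasDerivWithinAt_iff_isLittleO.1 hx).def hε
  obtain ⟨u, hu, hsub⟩ := mem_nhdsGE_iff_exists_Ico_subset.1 h1
  rw [mem_Ioi] at hu
  have hmem : Ioo 0 (min δ (min (u - t) S.Δ)) ∈ 𝓝[>] (0 : ℝ) :=
    Ioo_mem_nhdsGT (lt_min hδ (lt_min (by linarith) S.Δ_pos))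
  filter_upwards [hmem] with h hh
  have hh0 : 0 < h := hh.1
  have hhδ : h < δ := hh.2.trans_le (min_le_left _ _)
  have hhu : h < u - t := hh.2.trans_le ((min_le_right _ _).trans (min_le_left _ _))
  have hhΔ : h < S.Δ := hh.2.trans_le ((min_le_right _ _).trans (min_le_right _ _))
  refine (ContinuousMap.norm_le _ (by positivity)).2 fun τ => ?_
  have hτ := τ.2
  rw [ContinuousMap.sub_apply]
  change ‖(if (τ : ℝ) ≤ -h then _ else _) - x (t + h + τ)‖ ≤ ε * h
  split_ifs with hc
  · rw [ext_segment_at _ _ _ ⟨by linarith [hτ.1], by linarith⟩,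
      show t + (τ + h) = t + h + τ by ring, sub_self, norm_zero]
    positivity
  · set θ : ℝ := τ + h with hθ
    have hθ0 : 0 < θ := by linarith
    have hθh : θ ≤ h := by linarith [hτ.2]
    have h2 : ‖S.D.apply (segment_at S.Δ x (t + θ)) - S.D.apply (segment_at S.Δ x t) -
        (t + θ - t) • S.f (segment_at S.Δ x t)‖ ≤ ε * ‖t + θ - t‖ :=
      hsub ⟨by linarith, by linarith⟩
    rw [add_sub_cancel_left, Real.norm_of_nonneg hθ0.le] at h2
    -- As `θ` is smaller than every delay, freezing changes no delayed value: the sum is the one in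
    -- `𝒟 x_{t+θ}`. The error therefore has exactly the norm of the first-order remainder of `𝒟 x_s`
    -- at `t`, at most `ε θ ≤ ε h`.
    have h3 : S.D.apply (S.D.frozen (segment_at S.Δ x t) θ) =
        segment_at S.Δ x t S.D.zeroPt - ∑ j, S.D.coeff j (x (t + θ - S.delay j)) := by
      rw [DifferenceOperator.apply_eq, DifferenceOperator.frozen_apply,
        S.D.ext_of_nonneg _ (by simpa [DifferenceOperator.zeroPt] using hθ0.le)]
      congr 1
      refine Finset.sum_congr rfl fun j _ => ?_
      have hj := hd j
      have hjΔ := S.delay_le j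
      rw [DifferenceOperator.frozen_apply, show ((S.D.delayPt j : Icc (-S.Δ) (0 : ℝ)) : ℝ) =
        -S.delay j from rfl, ext_segment_at _ _ _ ⟨by linarith, by linarith⟩]
      congr 2
      ring
    have h4 := S.D.apply_segment_at x (t + θ)
    refine le_trans (le_of_eq ?_) (h2.trans (by gcongr))
    rw [h3, h4, norm_sub_rev, show t + h + (τ : ℝ) = t + θ by rw [hθ]; ring]
    congr 1
    abel

/-- A local Lipschitz constant of `V` preserves the `o(h)` error, so Driver's derivative at `x_t`
may be read as the upper right derivative of `V` along the solution. Both directions of the theorem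
rest on this. -/
theorem abs_comp_driverStep_sub_le {V : PhaseSpace n S.Δ → ℝ} (hV : LocallyLipschitz V)
    {x : C(ℝ, EuclideanSpace ℝ (Fin n))} {t : ℝ}
    (hx : HasDerivWithinAt (fun s : ℝ => S.D.apply (segment_at S.Δ x s))
      (S.f (segment_at S.Δ x t)) (Ici t) t) {ε : ℝ} (hε : 0 < ε) :
    ∀ᶠ h in 𝓝[>] (0 : ℝ),
      |V (S.driverStep (segment_at S.Δ x t) h) - V (segment_at S.Δ x (t + h))| ≤ ε * h := by
  obtain ⟨K, U, hU, hK⟩ := hV (segment_at S.Δ x t)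
  have hid : Tendsto (fun h : ℝ => h) (𝓝[>] 0) (𝓝 0) := tendsto_id.mono_left nhdsWithin_le_nhds
  have hseg : Tendsto (fun h => segment_at S.Δ x (t + h)) (𝓝[>] 0) (𝓝 (segment_at S.Δ x t)) := by
    have h1 : Continuous fun h => segment_at S.Δ x (t + h) :=
      (continuous_segment_at S.Δ x).comp (by fun_prop)
    have h2 := (h1.tendsto 0).mono_left (nhdsWithin_le_nhds (s := Ioi 0))
    rwa [add_zero] at h2
  have hdiff : Tendsto (fun h => S.driverStep (segment_at S.Δ x t) h - segment_at S.Δ x (t + h))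
      (𝓝[>] 0) (𝓝 0) := by
    refine squeeze_zero_norm' (S.norm_driverStep_sub_le hx one_pos) ?_
    exact hid.congr fun h => (one_mul h).symm
  have hstep : Tendsto (fun h => S.driverStep (segment_at S.Δ x t) h) (𝓝[>] 0)
      (𝓝 (segment_at S.Δ x t)) := by
    simpa using hdiff.add hseg
  have hε' : 0 < ε / (K + 1) := by positivity
  filter_upwards [hseg hU, hstep hU, S.norm_driverStep_sub_le hx hε', self_mem_nhdsWithin]
    with h h1 h2 h3 h4
  rw [mem_Ioi] at h4
  have h5 := hK.dist_le_mul _ h2 _ h1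
  rw [Real.dist_eq, dist_eq_norm] at h5
  refine h5.trans ?_
  calc (K : ℝ) * _ ≤ (K + 1) * (ε / (K + 1) * h) := by gcongr; linarith
    _ = ε * h := by field_simp

/-- A functional with `D⁺V ≤ -a V` decays exponentially along solutions. -/
theorem lyapunov_le_exp {V : PhaseSpace n S.Δ → ℝ} (hV : LocallyLipschitz V) {a : ℝ}
    (hD : ∀ φ, S.driverDeriv V φ ≤ ((-a * V φ : ℝ) : EReal))
    {x : C(ℝ, EuclideanSpace ℝ (Fin n))} {b : ℝ} (hb : 0 ≤ b)
    (hx : ∀ t, 0 ≤ t → t < b → HasDerivWithinAt (fun s : ℝ => S.D.apply (segment_at S.Δ x s))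
      (S.f (segment_at S.Δ x t)) (Ici 0) t) :
    V (segment_at S.Δ x b) ≤ V (segment_at S.Δ x 0) * Real.exp (-a * b) := by
  have h := le_gronwallBound_of_liminf_deriv_right_le (f := fun t => V (segment_at S.Δ x t))
    (f' := fun t => -a * V (segment_at S.Δ x t)) (δ := V (segment_at S.Δ x 0)) (K := -a) (ε := 0)
    (a := 0) (b := b) (hV.continuous.comp (continuous_segment_at S.Δ x)).continuousOn
    (fun t ht r hr => ?_) le_rfl (fun t _ => (add_zero _).ge) b ⟨hb, le_rfl⟩
  · rwa [gronwallBound_ε0, sub_zero] at h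
  -- The limsup bound controls difference quotients by `q`; half of the gap `r - q` absorbs the
  -- replacement of `φ_h` by `x_{t+h}`.
  · obtain ⟨q, hq1, hq2⟩ := exists_between hr
    have h1 := eventually_lt_of_limsup_lt ((hD (segment_at S.Δ x t)).trans_lt
      (EReal.coe_lt_coe_iff.2 hq1))
    have h2 := S.abs_comp_driverStep_sub_le hV
      ((hx t ht.1 ht.2).mono (Ici_subset_Ici.2 ht.1)) (ε := (r - q) / 2) (by linarith)
    have h3 : Tendsto (fun z => z - t) (𝓝[>] t) (𝓝[>] 0) := by
      refine tendsto_nhdsWithin_of_tendsto_nhds_of_eventually_within _ ?_ ?_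
      · have : Tendsto (fun z => z - t) (𝓝 t) (𝓝 (t - t)) := (by fun_prop : Continuous fun z =>
          z - t).tendsto t
        rw [sub_self] at this
        exact this.mono_left nhdsWithin_le_nhds
      · filter_upwards [self_mem_nhdsWithin] with z hz
        simpa using hz
    refine Eventually.frequently ?_
    filter_upwards [h3.eventually h1, h3.eventually h2, self_mem_nhdsWithin] with z h4 h5 h6
    rw [mem_Ioi] at h6
    have h7 : 0 < z - t := by linarith
    rw [EReal.coe_lt_coe_iff, one_div, inv_mul_lt_iff₀ h7] at h4
    rw [inv_mul_lt_iff₀ h7]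
    rw [add_sub_cancel] at h5
    have h8 := (abs_le.1 h5).1
    nlinarith

/-- A-priori decay of solutions on an interval, from a Lyapunov functional. -/
theorem exists_decay_of_lyapunov (hS : S.D.IsStable) {V : PhaseSpace n S.Δ → ℝ}
    (hV : LocallyLipschitz V) {a₁ a₂ a₃ : ℝ} (h₁ : 0 < a₁) (h₂ : 0 < a₂) (h₃ : 0 < a₃)
    (h : ∀ φ : PhaseSpace n S.Δ, (a₁ * ‖S.D.apply φ‖ ≤ V φ ∧ V φ ≤ a₂ * ‖φ‖) ∧
      S.driverDeriv V φ ≤ ((-a₃ * V φ : ℝ) : EReal)) :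
    ∃ K lam : ℝ, 0 < K ∧ 0 < lam ∧ ∀ (x : C(ℝ, EuclideanSpace ℝ (Fin n))) (b : ℝ), 0 ≤ b →
      (∀ t, 0 ≤ t → t < b → HasDerivWithinAt (fun s : ℝ => S.D.apply (segment_at S.Δ x s))
        (S.f (segment_at S.Δ x t)) (Ici 0) t) →
      ‖segment_at S.Δ x b‖ ≤ K * ‖segment_at S.Δ x 0‖ * Real.exp (-lam * b) := by
  obtain ⟨K, lam, hK, hlam, hdec⟩ := hS.exists_exp_decay h₃
  refine ⟨K * (1 + a₂ / a₁), lam, by positivity, hlam, fun x b hb hx => ?_⟩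
  have h4 := hdec x (a₂ / a₁ * ‖segment_at S.Δ x 0‖) b (fun t ht htb => ?_) b hb le_rfl
  · refine h4.trans (le_of_eq ?_)
    ring
  · have h5 := S.lyapunov_le_exp hV (fun φ => (h φ).2) ht fun s hs hst => hx s hs (by linarith)
    have h6 := (h (segment_at S.Δ x t)).1.1
    have h7 := mul_le_mul_of_nonneg_right (h (segment_at S.Δ x 0)).1.2
      (Real.exp_nonneg (-a₃ * t))
    rw [div_mul_eq_mul_div, div_mul_eq_mul_div, le_div_iff₀ h₁]
    linarith

/-- Existence is a first-exit argument. The truncated equation agrees with the original one until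
the norm of the segment first reaches `R`; the a priori bound, which needs the equation only before
that time, gives norm at most `K‖ξ‖ < R` there, a contradiction. -/
theorem isZeroGES_of_lyapunov (hf : LipschitzOnBoundedSets S.f) (hf0 : S.f 0 = 0)
    (hS : S.D.IsStable) {V : PhaseSpace n S.Δ → ℝ}
    (hV : LocallyLipschitz V) {a₁ a₂ a₃ : ℝ} (h₁ : 0 < a₁) (h₂ : 0 < a₂) (h₃ : 0 < a₃)
    (h : ∀ φ : PhaseSpace n S.Δ, (a₁ * ‖S.D.apply φ‖ ≤ V φ ∧ V φ ≤ a₂ * ‖φ‖) ∧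
      S.driverDeriv V φ ≤ ((-a₃ * V φ : ℝ) : EReal)) : S.IsZeroGES := by
  obtain ⟨K, lam, hK, hlam, hdec⟩ := S.exists_decay_of_lyapunov hS hV h₁ h₂ h₃ h
  refine ⟨K, lam, hK, hlam, fun ξ => ⟨?_, fun x hx t ht => ?_⟩⟩
  · set R := (K + 1) * ‖ξ‖ + 1 with hR
    have hR0 : 0 < R := by positivity
    obtain ⟨F, L, hL, hFL, hFf⟩ := hf.exists_truncation hf0 hR0
    obtain ⟨x, hx0, hx⟩ := S.D.exists_solution hL hFL ξ
    have hlt : ∀ t, 0 ≤ t → ‖segment_at S.Δ x t‖ < R := by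
      by_contra! hex
      set B : Set ℝ := {t | 0 ≤ t ∧ R ≤ ‖segment_at S.Δ x t‖} with hB
      have hBc : IsClosed B := by
        have := (continuous_segment_at S.Δ x).norm
        exact isClosed_Ici.inter (isClosed_le continuous_const this)
      have hBb : BddBelow B := ⟨0, fun t ht => ht.1⟩
      have hmem := hBc.csInf_mem hex hBb
      have h4 := hdec x (sInf B) hmem.1 fun s hs hsB => by
        have h5 : ‖segment_at S.Δ x s‖ ≤ R := by
          by_contra! h6
          exact absurd (csInf_le hBb (show s ∈ B from ⟨hs, h6.le⟩)) (not_le.2 hsB)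
        have h6 := hx s hs
        rwa [hFf _ h5] at h6
      rw [hx0] at h4
      have h5 : Real.exp (-lam * sInf B) ≤ 1 := by
        rw [Real.exp_le_one_iff]; nlinarith [hmem.1]
      have h6 : K * ‖ξ‖ * Real.exp (-lam * sInf B) ≤ K * ‖ξ‖ :=
        mul_le_of_le_one_right (by positivity) h5
      nlinarith [hmem.2, norm_nonneg ξ]
    refine ⟨x, hx0, fun t ht => ?_⟩
    have h6 := hx t ht
    rwa [hFf _ (hlt t ht).le] at h6
  · have h4 := hdec x t ht fun s hs _ => hx.2 s hs
    rw [hx.1] at h4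
    refine (norm_le_norm_segment_at x (by linarith [S.Δ_pos]) le_rfl).trans (h4.trans ?_)
    exact le_of_eq (by ring)

end NeutralSystem

/-! ### Dependence on initial data and the converse Lyapunov functional. -/

namespace NeutralSystem

variable {n p : ℕ} {S : NeutralSystem n p}

theorem IsSolution.hasDerivWithinAt_Ici {ξ : PhaseSpace n S.Δ}
    {x : C(ℝ, EuclideanSpace ℝ (Fin n))} (hx : S.IsSolution ξ x) {t : ℝ} (ht : 0 ≤ t) :
    HasDerivWithinAt (fun s : ℝ => S.D.apply (segment_at S.Δ x s))
      (S.f (segment_at S.Δ x t)) (Ici t) t :=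
  (hx.2 t ht).mono (Ici_subset_Ici.2 ht)

theorem IsSolution.shift {ξ : PhaseSpace n S.Δ} {x : C(ℝ, EuclideanSpace ℝ (Fin n))}
    (hx : S.IsSolution ξ x) {h : ℝ} (hh : 0 ≤ h) :
    S.IsSolution (segment_at S.Δ x h) (shift x h) := by
  refine ⟨by rw [segment_at_shift, zero_add], fun t ht => ?_⟩
  simp only [segment_at_shift]
  have h1 := (hx.2 (t + h) (by positivity)).scomp t (s := Ici 0)
    ((hasDerivWithinAt_id t (Ici 0)).add_const h) (fun s hs => by
      rw [mem_Ici] at hs ⊢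
      exact add_nonneg hs hh)
  rw [one_smul] at h1
  exact h1

/-- Lipschitz dependence of bounded solutions on the initial data over compact time intervals. -/
theorem exists_norm_segment_at_sub_le (hf : LipschitzOnBoundedSets S.f) {B T : ℝ} (hB : 0 < B)
    (hT : 0 ≤ T) : ∃ C : ℝ, 0 ≤ C ∧ ∀ ξ η x y, S.IsSolution ξ x → S.IsSolution η y →
      (∀ t, 0 ≤ t → ‖segment_at S.Δ x t‖ ≤ B) → (∀ t, 0 ≤ t → ‖segment_at S.Δ y t‖ ≤ B) →
      ∀ t, 0 ≤ t → t ≤ T → ‖segment_at S.Δ x t - segment_at S.Δ y t‖ ≤ C * ‖ξ - η‖ := by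
  obtain ⟨L, hL, hLip⟩ := hf B hB
  obtain ⟨γ, hγ, hγL, hw⟩ := S.D.exists_weight L
  have hΔ := S.Δ_pos
  have ha := S.D.coeffNorm_nonneg
  refine ⟨(Real.exp (γ * S.Δ) + 2) * (1 + (1 + S.D.coeffNorm)) * Real.exp (γ * T),
    by positivity, fun ξ η x y hx hy hxB hyB t ht htT => ?_⟩
  set G := (1 + S.D.coeffNorm) * ‖ξ - η‖ with hG
  have h0 : segment_at S.Δ (x - y) 0 = ξ - η := by rw [segment_at_sub, hx.1, hy.1]
  have hd : ∀ s, -S.Δ ≤ s → s ≤ T → ‖(x - y) s‖ ≤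
      (Real.exp (γ * S.Δ) + 2) * (‖ξ - η‖ + G) * Real.exp (γ * s) := by
    intro s hs hsT
    rw [← h0]
    refine S.D.norm_le_of_apply_le hγ hw (x - y) (T := T) (by positivity) hT
      (fun m hm hmb r hr hrT => ?_) hs hsT
    -- The barrier `G + (m/8) e^{γs}` starts above `‖𝒟(ξ - η)‖`, and its slope `(γm/8) e^{γs}`
    -- dominates `L m e^{γs}` because `γ ≥ 8L`.
    have h1 := image_norm_le_of_norm_deriv_right_le_deriv_boundary (a := 0) (b := r)
      (f := fun s => S.D.apply (segment_at S.Δ (x - y) s))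
      (f' := fun s => S.f (segment_at S.Δ x s) - S.f (segment_at S.Δ y s))
      (B := fun s => G + m / 8 * Real.exp (γ * s))
      (B' := fun s => m / 8 * (Real.exp (γ * s) * γ))
      (S.D.continuous_apply_segment_at (x - y)).continuousOn
      (fun s hs => ?_) ?_ (fun s => ?_) (fun s hs => ?_) ⟨hr, le_rfl⟩
    · have h2 := mul_nonneg hm (Real.exp_nonneg (γ * r))
      linarith
    · simp only [segment_at_sub, DifferenceOperator.apply_sub]
      exact (hx.hasDerivWithinAt_Ici hs.1).sub (hy.hasDerivWithinAt_Ici hs.1)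
    · rw [h0]
      exact (S.D.norm_apply_le _).trans (le_add_of_nonneg_right (by positivity))
    · have h2 : HasDerivAt (fun s : ℝ => γ * s) γ s := by
        simpa using (hasDerivAt_id s).const_mul γ
      exact (h2.exp.const_mul _).const_add _
    · refine (hLip _ _ (hxB s hs.1) (hyB s hs.1)).trans ?_
      rw [← segment_at_sub]
      have h2 := S.D.norm_segment_at_le_exp (x - y) hγ.le hm (t := s) fun q h3 h4 =>
        hmb q (by linarith [hs.1]) (by linarith [hs.2])
      have h3 := mul_nonneg hm (Real.exp_nonneg (γ * s))
      calc L * _ ≤ L * (m * Real.exp (γ * s)) := by gcongr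
        _ ≤ _ := by nlinarith
  rw [← segment_at_sub]
  refine (S.D.norm_segment_at_le_exp (x - y) hγ.le (by positivity) fun s h1 h2 =>
    hd s (by linarith) (by linarith)).trans ?_
  have h3 : Real.exp (γ * t) ≤ Real.exp (γ * T) := by gcongr
  calc _ ≤ (Real.exp (γ * S.Δ) + 2) * (‖ξ - η‖ + G) * Real.exp (γ * T) := by gcongr
    _ = _ := by rw [hG]; ring

/-- The exponential estimate of 0-GES in terms of segments. -/
theorem IsZeroGES.exists_norm_segment_at_le (h : S.IsZeroGES) :
    ∃ M μ : ℝ, 1 ≤ M ∧ 0 < μ ∧ ∀ ξ : PhaseSpace n S.Δ, (∃ x, S.IsSolution ξ x) ∧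
      ∀ x, S.IsSolution ξ x → ∀ t : ℝ, 0 ≤ t →
        ‖segment_at S.Δ x t‖ ≤ M * Real.exp (-(2 * μ) * t) * ‖ξ‖ := by
  obtain ⟨M, lam, hM, hlam, h⟩ := h
  have hΔ := S.Δ_pos
  have hE : 1 ≤ Real.exp (lam * S.Δ) := Real.one_le_exp (by positivity)
  -- The factor `exp (lam * Δ)` covers the reach of a segment into the past. Writing the rate as
  -- `2μ` leaves `e^{-μt}` to spare after multiplication by the weight `e^{μt}`.
  refine ⟨max M 1 * Real.exp (lam * S.Δ), lam / 2, ?_, by positivity, fun ξ =>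
    ⟨(h ξ).1, fun x hx t ht => ?_⟩⟩
  · exact one_le_mul_of_one_le_of_one_le (le_max_right _ _) hE
  rw [show -(2 * (lam / 2)) * t = -lam * t by ring, mul_assoc (max M 1), ← Real.exp_add]
  have hM1 : 1 ≤ max M 1 := le_max_right _ _
  refine (norm_segment_at_le_iff x t (by positivity)).2 fun s h1 h2 => ?_
  rcases le_total 0 s with hs | hs
  · refine ((h ξ).2 x hx s hs).trans ?_
    gcongr
    · exact le_max_left _ _
    · nlinarith
  · have h3 : ‖x s‖ ≤ ‖ξ‖ := by
      rw [← hx.1]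
      exact norm_le_norm_segment_at x (by linarith) hs
    have h4 : 1 ≤ Real.exp (lam * S.Δ + -lam * t) := Real.one_le_exp (by nlinarith)
    exact h3.trans (le_mul_of_one_le_left (norm_nonneg _)
      (one_le_mul_of_one_le_of_one_le hM1 h4))

/-- Lipschitz dependence with equal data. It identifies the shift of a chosen solution with the
solution chosen for the shifted segment. -/
theorem eq_on_of_isSolution (hf : LipschitzOnBoundedSets S.f) {ξ : PhaseSpace n S.Δ}
    {x y : C(ℝ, EuclideanSpace ℝ (Fin n))} (hx : S.IsSolution ξ x) (hy : S.IsSolution ξ y)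
    {B : ℝ} (hB : 0 < B) (hxB : ∀ t, 0 ≤ t → ‖segment_at S.Δ x t‖ ≤ B)
    (hyB : ∀ t, 0 ≤ t → ‖segment_at S.Δ y t‖ ≤ B) {t : ℝ} (ht : 0 ≤ t) :
    segment_at S.Δ x t = segment_at S.Δ y t := by
  obtain ⟨C, -, hC⟩ := exists_norm_segment_at_sub_le hf hB ht
  have h := hC ξ ξ x y hx hy hxB hyB t ht le_rfl
  rw [sub_self, norm_zero, mul_zero] at h
  exact sub_eq_zero.1 (norm_le_zero_iff.1 h)

/-- Converse Lyapunov theorem for 0-GES neutral systems. -/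
theorem IsZeroGES.exists_lyapunov (hf : LipschitzOnBoundedSets S.f) (h : S.IsZeroGES) :
    ∃ V : PhaseSpace n S.Δ → ℝ, (∀ φ, ‖φ‖ ≤ V φ) ∧ LocallyLipschitz V ∧
      ∃ a₂ a₃ : ℝ, 0 < a₂ ∧ 0 < a₃ ∧ ∀ φ : PhaseSpace n S.Δ, V φ ≤ a₂ * ‖φ‖ ∧
        S.driverDeriv V φ ≤ ((-a₃ * V φ : ℝ) : EReal) := by
  obtain ⟨M, μ, hM, hμ, h⟩ := h.exists_norm_segment_at_le
  choose X hX using fun ξ => (h ξ).1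
  have hdec : ∀ ξ x, S.IsSolution ξ x → ∀ t, 0 ≤ t →
      Real.exp (μ * t) * ‖segment_at S.Δ x t‖ ≤ M * Real.exp (-μ * t) * ‖ξ‖ := by
    intro ξ x hx t ht
    calc _ ≤ Real.exp (μ * t) * (M * Real.exp (-(2 * μ) * t) * ‖ξ‖) := by
          gcongr; exact (h ξ).2 x hx t ht
      _ = M * (Real.exp (μ * t) * Real.exp (-(2 * μ) * t)) * ‖ξ‖ := by ring
      _ = _ := by rw [← Real.exp_add]; congr 3; ring
  have hdec' : ∀ ξ x, S.IsSolution ξ x → ∀ t, 0 ≤ t →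
      Real.exp (μ * t) * ‖segment_at S.Δ x t‖ ≤ M * ‖ξ‖ := by
    intro ξ x hx t ht
    refine (hdec ξ x hx t ht).trans ?_
    have : Real.exp (-μ * t) ≤ 1 := by rw [Real.exp_le_one_iff]; nlinarith
    gcongr
    exact mul_le_of_le_one_right (by linarith) this
  have hbd : ∀ ξ x, S.IsSolution ξ x → ∀ t, 0 ≤ t → ‖segment_at S.Δ x t‖ ≤ M * ‖ξ‖ :=
    fun ξ x hx t ht => (le_mul_of_one_le_left (norm_nonneg _)
      (Real.one_le_exp (by positivity))).trans (hdec' ξ x hx t ht)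
  -- The term `t = 0` gives `‖φ‖ ≤ V φ`; the weight turns a time shift by `s` into the factor
  -- `e^{-μs}`.
  set V : PhaseSpace n S.Δ → ℝ := fun φ =>
    ⨆ t : NNReal, Real.exp (μ * t) * ‖segment_at S.Δ (X φ) t‖ with hV
  have hVge : ∀ φ t, 0 ≤ t → Real.exp (μ * t) * ‖segment_at S.Δ (X φ) t‖ ≤ V φ := fun φ t ht =>
    le_ciSup (f := fun t : NNReal => Real.exp (μ * t) * ‖segment_at S.Δ (X φ) t‖)
      ⟨M * ‖φ‖, by rintro _ ⟨s, rfl⟩; exact hdec' φ _ (hX φ) s s.2⟩ ⟨t, ht⟩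
  have hVle : ∀ φ c, (∀ t, 0 ≤ t → Real.exp (μ * t) * ‖segment_at S.Δ (X φ) t‖ ≤ c) → V φ ≤ c :=
    fun φ c hc => ciSup_le fun t => hc t t.2
  have hVnorm : ∀ φ, ‖φ‖ ≤ V φ := fun φ => by
    have := hVge φ 0 le_rfl
    rwa [mul_zero, Real.exp_zero, one_mul, (hX φ).1] at this
  have hVup : ∀ φ, V φ ≤ M * ‖φ‖ := fun φ => hVle φ _ (hdec' φ _ (hX φ))
  have hVlip : ∀ H, 0 < H → ∃ K, 0 ≤ K ∧ ∀ φ ψ, ‖φ‖ ≤ H → ‖ψ‖ ≤ H →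
      V φ ≤ V ψ + K * ‖φ - ψ‖ := by
    intro H hH
    -- From time `log M / μ` on, `M e^{-μt} ≤ 1`, so the terms of the supremum are at most `‖φ‖ ≤
    -- ‖ψ‖ + ‖φ - ψ‖ ≤ V ψ + ‖φ - ψ‖`. Dependence on data is needed only before that time.
    have hT : 0 ≤ Real.log M / μ := div_nonneg (Real.log_nonneg hM) hμ.le
    obtain ⟨C, hC0, hC⟩ := exists_norm_segment_at_sub_le hf (B := M * H) (by positivity) hT
    have hE := Real.exp_pos (μ * (Real.log M / μ))
    refine ⟨Real.exp (μ * (Real.log M / μ)) * C + 1, by positivity, fun φ ψ hφ hψ =>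
      hVle φ _ fun t ht => ?_⟩
    have hEC : 0 ≤ Real.exp (μ * (Real.log M / μ)) * C * ‖φ - ψ‖ := by positivity
    have hn := norm_nonneg (φ - ψ)
    rcases le_total t (Real.log M / μ) with htT | htT
    · have h1 := hC φ ψ _ _ (hX φ) (hX ψ)
        (fun t ht => (hbd φ _ (hX φ) t ht).trans (by gcongr))
        (fun t ht => (hbd ψ _ (hX ψ) t ht).trans (by gcongr)) t ht htT
      have h2 := norm_le_norm_sub_add (segment_at S.Δ (X φ) t) (segment_at S.Δ (X ψ) t)
      have h3 : Real.exp (μ * t) ≤ Real.exp (μ * (Real.log M / μ)) := by gcongr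
      calc Real.exp (μ * t) * ‖segment_at S.Δ (X φ) t‖
          ≤ Real.exp (μ * t) * (C * ‖φ - ψ‖ + ‖segment_at S.Δ (X ψ) t‖) := by
            gcongr; linarith
        _ = Real.exp (μ * t) * ‖segment_at S.Δ (X ψ) t‖ + Real.exp (μ * t) * (C * ‖φ - ψ‖) := by
            ring
        _ ≤ V ψ + Real.exp (μ * (Real.log M / μ)) * (C * ‖φ - ψ‖) := by
            gcongr; exact hVge ψ t ht
        _ ≤ _ := by linarith
    · have h1 := hdec φ _ (hX φ) t ht
      have h2 : M * Real.exp (-μ * t) ≤ 1 := by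
        rw [div_le_iff₀ hμ] at htT
        have h3 : Real.exp (Real.log M) ≤ Real.exp (μ * t) := by gcongr; linarith
        rw [Real.exp_log (by linarith)] at h3
        rw [neg_mul, Real.exp_neg, mul_inv_le_iff₀ (Real.exp_pos _)]
        linarith
      have h3 := mul_le_of_le_one_left (norm_nonneg φ) h2
      have h4 := norm_le_norm_sub_add φ ψ
      have h5 := hVnorm ψ
      linarith
  have hVloc : LocallyLipschitz V := by
    intro φ
    obtain ⟨K, hK, hKV⟩ := hVlip (‖φ‖ + 1) (by positivity)
    refine ⟨⟨K, hK⟩, Metric.closedBall 0 (‖φ‖ + 1), Metric.closedBall_mem_nhds_of_mem (by simp),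
      LipschitzOnWith.of_dist_le_mul fun ψ₁ h₁ ψ₂ h₂ => ?_⟩
    rw [mem_closedBall_zero_iff] at h₁ h₂
    rw [Real.dist_eq, dist_eq_norm, abs_sub_le_iff]
    have h3 := hKV _ _ h₁ h₂
    have h4 := hKV _ _ h₂ h₁
    rw [norm_sub_rev] at h4
    constructor
    · change _ ≤ K * _
      linarith
    · change _ ≤ K * _
      linarith
  -- By uniqueness the solution from `x_s` is the shifted one, and `e^{μt} = e^{-μs} e^{μ(t+s)}`.
  have hVdec : ∀ φ s, 0 ≤ s → V (segment_at S.Δ (X φ) s) ≤ Real.exp (-μ * s) * V φ := by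
    intro φ s hs
    refine hVle _ _ fun t ht => ?_
    have hsol := (hX φ).shift hs
    set B := M * ‖segment_at S.Δ (X φ) s‖ + 1 with hB
    have heq := eq_on_of_isSolution hf (hX (segment_at S.Δ (X φ) s)) hsol (B := B) (by positivity)
      (fun t ht => (hbd _ _ (hX _) t ht).trans (by linarith))
      (fun t ht => (hbd _ _ hsol t ht).trans (by linarith)) ht
    rw [heq, segment_at_shift]
    have h1 := hVge φ (t + s) (by positivity)
    calc _ = Real.exp (-μ * s) * (Real.exp (μ * (t + s)) * ‖segment_at S.Δ (X φ) (t + s)‖) := by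
          rw [← mul_assoc, ← Real.exp_add]; congr 2; ring
      _ ≤ _ := by gcongr
  refine ⟨V, hVnorm, hVloc, M, μ, by linarith, hμ, fun φ => ⟨hVup φ, ?_⟩⟩
  -- It suffices to bound the limsup by each real `r > -μ V φ`. For an intermediate `q`, the
  -- quotient of `e^{-μs} V φ` is eventually below `q`, and `r - q` covers the error of
  -- `driverStep`.
  refine EReal.le_of_forall_lt_iff_le.1 fun r hr => ?_
  rw [EReal.coe_lt_coe_iff] at hr
  obtain ⟨q, hq1, hq2⟩ := exists_between hr
  have hder : HasDerivAt (fun s : ℝ => Real.exp (-μ * s) * V φ) (-μ * V φ) 0 := by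
    have h1 : HasDerivAt (fun s : ℝ => -μ * s) (-μ) 0 := by
      simpa using (hasDerivAt_id (0 : ℝ)).const_mul (-μ)
    simpa using h1.exp.mul_const (V φ)
  have h1 := hder.hasDerivWithinAt (s := Ioi 0)
  rw [hasDerivWithinAt_iff_tendsto_slope' (by simp)] at h1
  have h2 := S.abs_comp_driverStep_sub_le hVloc ((hX φ).hasDerivWithinAt_Ici le_rfl)
    (ε := r - q) (by linarith)
  refine limsup_le_of_le (by isBoundedDefault) ?_
  filter_upwards [h1.eventually (gt_mem_nhds hq1), h2, self_mem_nhdsWithin] with s h3 h4 h5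
  rw [mem_Ioi] at h5
  rw [(hX φ).1, zero_add] at h4
  rw [slope_def_field, sub_zero, div_lt_iff₀ h5, mul_zero, Real.exp_zero, one_mul] at h3
  rw [EReal.coe_le_coe_iff, one_div, inv_mul_le_iff₀ h5]
  have h6 := (abs_le.1 h4).2
  have h7 := hVdec φ s h5.le
  linarith

end NeutralSystem

/-! ### The equivalence. -/

theorem mainTheorem2 {n p : ℕ} (hn : 0 < n) (hp : 0 < p) (S : NeutralSystem n p)
    (hf : LipschitzOnBoundedSets S.f) (hf0 : S.f 0 = 0)
    (hD : S.D.IsStronglyStable) :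
    S.IsZeroGES ↔
      ∃ V : PhaseSpace n S.Δ → ℝ, (∀ φ, 0 ≤ V φ) ∧ LocallyLipschitz V ∧
        ∃ a₁ a₂ a₃ : ℝ, 0 < a₁ ∧ 0 < a₂ ∧ 0 < a₃ ∧
          ∀ φ : PhaseSpace n S.Δ,
            (a₁ * ‖S.D.apply φ‖ ≤ V φ ∧ V φ ≤ a₂ * ‖φ‖) ∧
            S.driverDeriv V φ ≤ ((-a₃ * V φ : ℝ) : EReal) := by
  constructor
  · intro h
    obtain ⟨V, hV, hVl, a₂, a₃, h₂, h₃, hVD⟩ := h.exists_lyapunov hf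
    have ha : 0 < 1 + S.D.coeffNorm := by linarith [S.D.coeffNorm_nonneg]
    -- The converse functional dominates the full norm, and `‖𝒟φ‖ ≤ (1 + coeffNorm)‖φ‖` converts
    -- this into the lower bound with `a₁ = (1 + coeffNorm)⁻¹`.
    refine ⟨V, fun φ => (norm_nonneg φ).trans (hV φ), hVl, (1 + S.D.coeffNorm)⁻¹, a₂, a₃,
      inv_pos.2 ha, h₂, h₃, fun φ => ⟨⟨?_, (hVD φ).1⟩, (hVD φ).2⟩⟩
    exact ((inv_mul_le_iff₀ ha).2 (S.D.norm_apply_le φ)).trans (hV φ)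
  · rintro ⟨V, -, hVl, a₁, a₂, a₃, h₁, h₂, h₃, hVD⟩
    exact S.isZeroGES_of_lyapunov hf hf0 (hD S.D rfl) hVl h₁ h₂ h₃ hVD
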